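/- Let $\overline A=\{x_0,x_1,\dots,x_n\}$ be a finite set with $n+1$ elements, $n\ge 0$, let $P=(p(x,y))$ be the transition matrix of an irreducible Markov chain on $\overline A$, and let $A=\{x_1,\dots,x_n\}$. For $B\subset A$ let $P_B$ be the restriction of $P$ to $B\times B$ and $G_B(x,y)=\sum_{k\ge 0}(P_B^k)(x,y)$ the Green's function. Put $$F(A)=\prod_{j=1}^n G_{A_j}(y_j,y_j),\qquad A_j=A\setminus\{y_1,\dots,y_{j-1}\},$$ where $y_1,\dots,y_n$ is any enumeration of $A$. For a spanning tree $\mathcal T$ of the complete graph on $\overline A$, orient each edge towards $x_0$ and let $p(\mathcal T;x_0)=\prod p(u,v)$, the product over the directed edges $(u,v)$ of $\mathcal T$. Wilson's algorithm with root $x_0$ uses independent Markov chains $S^1,\dots,S^n$ with transition matrix $P$, $S^i$ starting at $x_i$. It starts with the tree consisting of the single vertex $x_0$. As long as some vertex is not in the tree, let $j$ be the smallest index such that $x_j$ is not in the tree, run $S^j$ until its first visit to the tree, erase its loops chronologically, and add the vertices and edges of the resulting self-avoiding path to the tree. 1. With probability one Wilson's algorithm terminates and outputs a spanning tree of the complete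 graph on $\overline A$, and for each such spanning tree $\mathcal T$ the probability that the output is $\mathcal T$ is $p(\mathcal T;x_0)\,F(A)$. 2. Consequently, the sum being over all spanning trees of the complete graph on $\overline A$, $$\sum_{\mathcal T}p(\mathcal T;x_0)=\frac1{F(A)}=\det(I-P_A).$$ 3. (Kirchhoff) Let $G$ be a finite simple graph and $r$ a vertex of $G$. The number of spanning trees of $G$ equals the determinant of the reduced graph Laplacian, that is, of the matrix obtained from (diagonal matrix of degrees) $-$ (adjacency matrix) by deleting the row and the column of $r$. -/

import Mathlib

open MeasureTheory ProbabilityTheory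

/-! ### Loop erasure -/

/-- Chronological loop erasure of a path, given as the list of its vertices: keep the first
vertex `v`, jump to the last visit to `v`, and continue from the vertex visited right after it.
Here `l.rtakeWhile (fun u => decide (u ≠ v))` is the part of `l` after the last visit to `v`
(all of `l` when `l` does not visit `v`). -/
def loopErase {V : Type*} [DecidableEq V] : List V → List V
  | [] => []
  | v :: l => v :: loopErase (l.rtakeWhile (fun u => decide (u ≠ v)))
termination_by l => l.length
decreasing_by
  exact Nat.lt_succ_of_le (List.rtakeWhile_suffix _ l).length_le

/-! ### Markov chains, the Green's function and the quantity `F` -/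

/-- `S` is a (time-homogeneous) Markov chain with transition matrix `P` started at `v`,
expressed by its finite-dimensional distributions. -/
structure IsMarkovChainFrom {V Ω : Type*} [MeasurableSpace V] [DecidableEq V]
    [MeasurableSpace Ω] (μ : Measure Ω) (P : Matrix V V ℝ) (v : V) (S : ℕ → Ω → V) : Prop where
  measurable (k : ℕ) : Measurable (S k)
  law (m : ℕ) (a : ℕ → V) :
    μ {ω | ∀ k ≤ m, S k ω = a k} =
      if a 0 = v then ENNReal.ofReal (∏ k ∈ Finset.range m, P (a k) (a (k + 1))) else 0

/-- The transition matrix of the chain killed on leaving `A`: the matrix `P` restricted to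
`A × A`, extended by zero. -/
def killed {V : Type*} [DecidableEq V] (P : Matrix V V ℝ) (A : Finset V) : Matrix V V ℝ :=
  Matrix.of fun u v => if u ∈ A ∧ v ∈ A then P u v else 0

/-- The Green's function `G_A(u, v) = ∑ₖ (P_A ^ k)(u, v)`, for `u, v ∈ A`: the expected number of
visits to `v` before leaving `A` of the chain started at `u`. -/
noncomputable def green {V : Type*} [Fintype V] [DecidableEq V] (P : Matrix V V ℝ)
    (A : Finset V) (u v : V) : ℝ :=
  ∑' k : ℕ, (killed P A ^ k) u v

/-- `F_{v₁,…,vₘ}(A) = ∏ⱼ G_{A_j}(vⱼ, vⱼ)` with `A_j = A \ {v₁, …, v_{j-1}}`, for an ordered list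
`[v₁, …, vₘ]` of distinct vertices of `A`. When the list enumerates `A` this is `F(A)`. -/
noncomputable def loopF {V : Type*} [Fintype V] [DecidableEq V] (P : Matrix V V ℝ) :
    Finset V → List V → ℝ
  | _, [] => 1
  | A, v :: l => green P A v v * loopF P (A.erase v) l

/-! ### Spanning trees and their weights -/

/-- The spanning trees of a finite graph `G`. -/
noncomputable def spanningTrees {V : Type*} [Finite V] (G : SimpleGraph V) :
    Finset (SimpleGraph V) :=
  (Set.toFinite {T : SimpleGraph V | T ≤ G ∧ T.IsTree}).toFinset

/-- `(u, v)` is a directed edge of the tree `T` oriented towards `r`: the edge `u v` of `T`,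
traversed from `u` to `v`, is the first step of a self-avoiding path in `T` from `u` to `r`. -/
def IsDirectedEdge {V : Type*} (T : SimpleGraph V) (r u v : V) : Prop :=
  ∃ (h : T.Adj u v) (w : T.Walk v r), (SimpleGraph.Walk.cons h w).IsPath

open Classical in
/-- The weight `p(T; r)`: the product of `P u v` over all edges `(u, v)` of `T` directed towards
the root `r`. -/
noncomputable def treeWeight {V : Type*} [Fintype V] (P : Matrix V V ℝ) (r : V)
    (T : SimpleGraph V) : ℝ :=
  ∏ e : V × V with IsDirectedEdge T r e.1 e.2, P e.1 e.2

/-! ### Wilson's algorithm -/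

/-- The trajectory `w`, stopped at its first visit to `B` (for trajectories that do visit `B`). -/
noncomputable def pathTo {V : Type*} (w : ℕ → V) (B : Finset V) : List V :=
  (List.range (sInf {k : ℕ | w k ∈ B} + 1)).map w

/-- A stage of Wilson's algorithm: the vertices already connected to the root, and the graph
formed by the edges chosen so far. -/
structure WilsonState (V : Type*) where
  connected : Finset V
  graph : SimpleGraph V

/-- The graph formed by the edges traversed by a path. -/
def pathEdges {V : Type*} (l : List V) : SimpleGraph V :=
  SimpleGraph.fromRel fun u v => [u, v] <:+: l

open Classical in
/-- One step of Wilson's algorithm. The vertices are `x 0` (the root), `x 1, …, x n`, and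
`w i` is the trajectory to be used from the vertex `x i.succ`. If all vertices are connected, stop.
Otherwise take the unconnected vertex of smallest index, run its walk until it hits the connected
set, erase the loops and add the resulting path. (A walk that never hits the connected set
never ends, and then the algorithm does not progress.) -/
noncomputable def wilsonStep {V : Type*} [DecidableEq V] {n : ℕ} (x : Fin (n + 1) ≃ V)
    (w : Fin n → ℕ → V) (s : WilsonState V) : WilsonState V :=
  if h : (Finset.univ.filter fun i : Fin n => x i.succ ∉ s.connected).Nonempty then
    let i := (Finset.univ.filter fun i : Fin n => x i.succ ∉ s.connected).min' h
    if ∃ k, w i k ∈ s.connected then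
      let η := loopErase (pathTo (w i) s.connected)
      ⟨s.connected ∪ η.toFinset, s.graph ⊔ pathEdges η⟩
    else s
  else s

/-- The output of Wilson's algorithm with root `x 0`, as a function of the trajectories used.
Each step connects at least one more of the `n` vertices other than the root, so `n` steps
suffice. -/
noncomputable def wilson {V : Type*} [DecidableEq V] {n : ℕ} (x : Fin (n + 1) ≃ V)
    (w : Fin n → ℕ → V) : SimpleGraph V :=
  ((wilsonStep x w)^[n] ⟨{x 0}, ⊥⟩).graph

/-! Both the loop factors and the tree sum reduce to determinants. For a proper subset `A` the
maximum principle makes `1 - P_A` invertible, its inverse is the Green's function, and Cramer's rule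
gives `G_A(v,v) = det(1 - P_{A∖v}) / det(1 - P_A)` (`green_self`). The product defining `F`
therefore telescopes (`loopF_eq_det`): `F(A)` is `1 / det(1 - P_A)` and does not depend on the
enumeration.

To weigh all paths with loop erasure `η`, cut such a path at its last visit to each successive
vertex of `η`. The loops at the `j`-th vertex avoid the earlier ones and contribute
`G_{A_j}(v_j,v_j)`, so the total is the weight of `η` times `F_η(A)` (`tsum_pathWeight_loopErase`).

Wilson's algorithm outputs `T` exactly when each walk it uses has as loop erasure the branch of `T`
from its starting point to the part already built (`exists_events_wilson`). By independence the
probabilities multiply: the edge weights assemble to `p(T; x₀)` and the loop factors telescope to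
`F(A)`, whatever branches occur (`measure_wilson_eq`).

Every walk hits the root almost surely, so the output is almost surely a tree and the probabilities
sum to one. Applied to chains constructed explicitly, this gives the tree sum. For Kirchhoff's
theorem on a connected graph take the lazy walk: all spanning trees have the same weight, and `1 -
P` is the Laplacian with its rows rescaled. For a disconnected graph both sides vanish. -/

/-! ### The Green's function and determinants. -/

section Green

variable {V : Type*} [Fintype V] [DecidableEq V] {P : Matrix V V ℝ}

omit [Fintype V] in
theorem killed_apply (P : Matrix V V ℝ) (A : Finset V) (u v : V) :
    killed P A u v = if u ∈ A ∧ v ∈ A then P u v else 0 := rfl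

omit [Fintype V] in
theorem killed_empty (P : Matrix V V ℝ) : killed P ∅ = 0 := by
  ext u v; simp [killed_apply]

omit [Fintype V] [DecidableEq V] in
/-- A nonempty set which an irreducible chain cannot leave is everything. -/
theorem Matrix.IsIrreducible.mem_of_closed (h : P.IsIrreducible) {s : Set V} {u : V} (hu : u ∈ s)
    (hs : ∀ u ∈ s, ∀ v, 0 < P u v → v ∈ s) (v : V) : v ∈ s := by
  let := P.toQuiver
  obtain ⟨p, -⟩ := h.connected u v
  induction p with
  | nil => exact hu
  | cons p e ih => exact hs _ ih _ e.down

/-- Maximum principle: if `f = P_A f`, averaging forces every vertex reachable in one step from a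
maximum of `|f|` to be a maximum too. By irreducibility `|f|` is constant, yet `f` vanishes off `A`.
-/
theorem det_one_sub_killed_ne_zero (hP : P ∈ Matrix.rowStochastic ℝ V) (hirr : P.IsIrreducible)
    {A : Finset V} (hA : A ≠ Finset.univ) : (1 - killed P A).det ≠ 0 := by
  intro hdet
  obtain ⟨f, hf0, hf⟩ := Matrix.exists_mulVec_eq_zero_iff.mpr hdet
  have hfix : ∀ u, f u = ∑ w, killed P A u w * f w := by
    intro u
    have := congrFun hf u
    rw [Matrix.sub_mulVec, Matrix.one_mulVec] at this
    simpa [sub_eq_zero, Matrix.mulVec, dotProduct] using this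
  have hout : ∀ u ∉ A, f u = 0 := by
    intro u hu
    rw [hfix u]
    simp [killed_apply, hu]
  obtain ⟨x, hx⟩ : ∃ x, f x ≠ 0 := by
    by_contra! h
    exact hf0 (funext h)
  obtain ⟨m, -, hm⟩ := Finset.exists_max_image Finset.univ (fun u => |f u|) ⟨x, Finset.mem_univ x⟩
  have hpos : 0 < |f m| := (abs_pos.mpr hx).trans_le (hm x (Finset.mem_univ x))
  apply hA
  ext v
  simp only [Finset.mem_univ, iff_true]
  have key := hirr.mem_of_closed (s := {u | |f u| = |f m|}) (u := m) rfl ?_ v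
  · by_contra hv
    have h0 : |f v| = |f m| := key
    rw [hout v hv, abs_zero] at h0
    exact hpos.ne h0
  · intro u hu v huv
    by_contra hv
    have hlt : |f v| < |f m| := lt_of_le_of_ne (hm v (Finset.mem_univ v)) hv
    have h1 : |f u| ≤ ∑ w, P u w * |f w| := by
      rw [hfix u]
      refine (Finset.abs_sum_le_sum_abs _ _).trans (Finset.sum_le_sum fun w _ => ?_)
      rw [abs_mul]
      refine mul_le_mul_of_nonneg_right ?_ (abs_nonneg _)
      rw [killed_apply]
      split_ifs
      · rw [abs_of_nonneg (hirr.nonneg _ _)]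
      · simpa using hirr.nonneg u w
    have h2 : ∑ w, P u w * |f w| < ∑ w, P u w * |f m| :=
      Finset.sum_lt_sum
        (fun w _ => mul_le_mul_of_nonneg_left (hm w (Finset.mem_univ w)) (hirr.nonneg _ _))
        ⟨v, Finset.mem_univ v, mul_lt_mul_of_pos_left hlt huv⟩
    rw [← Finset.sum_mul, Matrix.sum_row_of_mem_rowStochastic hP, one_mul] at h2
    have h3 : |f u| = |f m| := hu
    linarith

theorem killed_nonneg (hP : P ∈ Matrix.rowStochastic ℝ V) (A : Finset V) (u v : V) :
    0 ≤ killed P A u v := by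
  rw [killed_apply]
  split_ifs
  · exact Matrix.nonneg_of_mem_rowStochastic hP
  · exact le_rfl

theorem killed_pow_nonneg (hP : P ∈ Matrix.rowStochastic ℝ V) (A : Finset V) (k : ℕ) (u v : V) :
    0 ≤ (killed P A ^ k) u v :=
  Matrix.pow_apply_nonneg (killed_nonneg hP A) k u v

theorem sum_killed_pow_le_one (hP : P ∈ Matrix.rowStochastic ℝ V) (A : Finset V) (k : ℕ) (u : V) :
    ∑ v, (killed P A ^ k) u v ≤ 1 := by
  induction k generalizing u with
  | zero => simp [Matrix.one_apply]
  | succ k ih =>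
    simp_rw [pow_succ', Matrix.mul_apply]
    rw [Finset.sum_comm]
    simp_rw [← Finset.mul_sum]
    calc ∑ w, killed P A u w * ∑ v, (killed P A ^ k) w v
        ≤ ∑ w, P u w := by
          refine Finset.sum_le_sum fun w _ => ?_
          refine (mul_le_of_le_one_right (killed_nonneg hP A u w) (ih w)).trans ?_
          rw [killed_apply]
          split_ifs
          · exact le_rfl
          · exact Matrix.nonneg_of_mem_rowStochastic hP
      _ = 1 := Matrix.sum_row_of_mem_rowStochastic hP u

theorem killed_pow_le_one (hP : P ∈ Matrix.rowStochastic ℝ V) (A : Finset V) (k : ℕ) (u v : V) :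
    (killed P A ^ k) u v ≤ 1 :=
  (Finset.single_le_sum (f := fun v => (killed P A ^ k) u v)
    (fun v _ => killed_pow_nonneg hP A k u v) (Finset.mem_univ v)).trans
    (sum_killed_pow_le_one hP A k u)

/-- The partial sums are `(1 - Q)⁻¹ (1 - Q ^ N)`, and the entries of `1 - Q ^ N` lie in `[-1, 1]`,
which bounds them uniformly in `N`. -/
theorem summable_killed_pow (hP : P ∈ Matrix.rowStochastic ℝ V) (hirr : P.IsIrreducible)
    {A : Finset V} (hA : A ≠ Finset.univ) (u v : V) :
    Summable fun k : ℕ => (killed P A ^ k) u v := by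
  set Q := killed P A with hQ
  have hdet : IsUnit (1 - Q).det := (det_one_sub_killed_ne_zero hP hirr hA).isUnit
  refine summable_of_sum_range_le (c := ∑ w, |(1 - Q)⁻¹ u w|)
    (fun k => killed_pow_nonneg hP A k u v) fun N => ?_
  have hgeom : ∑ k ∈ Finset.range N, Q ^ k = (1 - Q)⁻¹ * (1 - Q ^ N) := by
    rw [← mul_neg_geom_sum, ← mul_assoc, Matrix.nonsing_inv_mul _ hdet, one_mul]
  have h1 : ∑ k ∈ Finset.range N, (Q ^ k) u v = ((1 - Q)⁻¹ * (1 - Q ^ N)) u v := by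
    rw [← hgeom, Matrix.sum_apply]
  rw [h1, Matrix.mul_apply]
  refine Finset.sum_le_sum fun w _ => ?_
  refine (le_abs_self _).trans ?_
  rw [abs_mul]
  refine mul_le_of_le_one_right (abs_nonneg _) ?_
  have h2 := killed_pow_nonneg hP A N w v
  have h3 := killed_pow_le_one hP A N w v
  rw [← hQ] at h2 h3
  rw [Matrix.sub_apply, Matrix.one_apply, abs_le]
  split_ifs <;> constructor <;> linarith

theorem green_eq_inv (hP : P ∈ Matrix.rowStochastic ℝ V) (hirr : P.IsIrreducible)
    {A : Finset V} (hA : A ≠ Finset.univ) (u v : V) :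
    green P A u v = (1 - killed P A)⁻¹ u v := by
  have hs := summable_killed_pow hP hirr hA
  have hdet : IsUnit (1 - killed P A).det := (det_one_sub_killed_ne_zero hP hirr hA).isUnit
  have hmul : (1 - killed P A) * Matrix.of (green P A) = 1 := by
    ext a b
    rw [sub_mul, one_mul, Matrix.sub_apply, Matrix.mul_apply]
    simp only [Matrix.of_apply, green]
    simp_rw [← tsum_mul_left]
    -- Multiplying the series by `P_A` shifts it by one, so the difference is its zeroth term, the
    -- identity.
    rw [← Summable.tsum_finsetSum (fun w _ => (hs w b).mul_left _)]
    simp_rw [← Matrix.mul_apply, ← pow_succ']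
    rw [(hs a b).tsum_eq_zero_add]
    simp
  rw [Matrix.inv_eq_right_inv hmul, Matrix.of_apply]

/-- Both sides are the `(v, v)` cofactor, obtained once by replacing a row and once by replacing a
column. -/
theorem Matrix.det_updateCol_single_of_row {R : Type*} [CommRing R] (M : Matrix V V R) (v : V)
    (hM : M v = Pi.single v 1) : (M.updateCol v (Pi.single v 1)).det = M.det := by
  have h1 : M.adjugate v v = M.det := by
    rw [Matrix.adjugate_apply, ← hM, Matrix.updateRow_eq_self]
  rw [← h1, ← Matrix.transpose_apply M.adjugate, Matrix.adjugate_transpose,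
    Matrix.adjugate_apply, Matrix.updateRow_transpose, Matrix.det_transpose]

/-- Cramer's rule: the cofactor replaces row `v` by a unit vector. Column `v` may then be replaced
as well, and the result is `1 - P` killed outside `A.erase v`. -/
theorem green_self (hP : P ∈ Matrix.rowStochastic ℝ V) (hirr : P.IsIrreducible)
    {A : Finset V} (hA : A ≠ Finset.univ) (v : V) :
    green P A v v = (1 - killed P (A.erase v)).det / (1 - killed P A).det := by
  rw [green_eq_inv hP hirr hA, Matrix.inv_def, Matrix.smul_apply, Ring.inverse_eq_inv', smul_eq_mul,
    div_eq_inv_mul, Matrix.adjugate_apply,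
    ← Matrix.det_updateCol_single_of_row _ v (Matrix.updateRow_self ..)]
  congr 2
  ext a b
  by_cases hb : b = v
  · subst hb
    by_cases ha : a = b <;> simp [killed_apply, ha]
  · by_cases ha : a = v
    · subst ha
      simp [killed_apply, hb, Ne.symm hb]
    · simp [killed_apply, hb, ha]

/-- The determinant ratios of `green_self` telescope along the list. -/
theorem loopF_eq_det (hP : P ∈ Matrix.rowStochastic ℝ V) (hirr : P.IsIrreducible)
    {A : Finset V} (hA : A ≠ Finset.univ) (l : List V) :
    loopF P A l = (1 - killed P (A \ l.toFinset)).det / (1 - killed P A).det := by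
  induction l generalizing A with
  | nil => simp [loopF, div_self (det_one_sub_killed_ne_zero hP hirr hA)]
  | cons v l ih =>
    have hA' : A.erase v ≠ Finset.univ := by
      intro h
      have := h ▸ Finset.mem_univ v
      simp at this
    rw [loopF, ih hA', green_self hP hirr hA, mul_comm,
      div_mul_div_cancel₀ (det_one_sub_killed_ne_zero hP hirr hA')]
    congr 4
    ext a
    simp only [Finset.mem_sdiff, Finset.mem_erase, List.mem_toFinset, List.mem_cons]
    tauto

theorem loopF_erase_univ (hP : P ∈ Matrix.rowStochastic ℝ V) (hirr : P.IsIrreducible) {r : V}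
    {l : List V} (hl : ∀ v, v ∈ l ↔ v ≠ r) :
    loopF P (Finset.univ.erase r) l = ((1 - killed P (Finset.univ.erase r)).det)⁻¹ := by
  have h : Finset.univ.erase r ≠ Finset.univ := fun h => by
    have := h ▸ Finset.mem_univ r
    simp at this
  have h' : Finset.univ.erase r \ l.toFinset = ∅ := by
    ext a
    simp [hl]
  rw [loopF_eq_det hP hirr h, h', killed_empty, sub_zero, Matrix.det_one, one_div]

/-- Killing by zero extension leaves an identity block at `r`, which contributes a factor one. -/
theorem det_one_sub_killed_erase_univ (P : Matrix V V ℝ) (r : V) :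
    (1 - killed P (Finset.univ.erase r)).det =
      (1 - P.submatrix (Subtype.val : {v // v ≠ r} → V) Subtype.val).det := by
  rw [Matrix.twoBlockTriangular_det _ (fun v => v ≠ r)]
  · have h1 : (Matrix.toSquareBlockProp (1 - killed P (Finset.univ.erase r)) fun v => ¬ v ≠ r) = 1 := by
      ext ⟨a, ha⟩ ⟨b, hb⟩
      simp only [not_not] at ha hb
      subst ha hb
      simp [Matrix.toSquareBlockProp, killed_apply]
    rw [h1, Matrix.det_one, mul_one]
    congr 1
    ext ⟨a, ha⟩ ⟨b, hb⟩
    simp [Matrix.toSquareBlockProp, killed_apply, Matrix.one_apply, ha, hb]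
  · intro i hi j hj
    have : i ≠ j := fun h => hi (h ▸ hj)
    simp only [not_not] at hi
    simp [killed_apply, hi, hi ▸ this]

end Green

/-! ### Chronological loop erasure. -/

section LoopErase

variable {V : Type*} [DecidableEq V]

theorem loopErase_nil : loopErase ([] : List V) = [] := by rw [loopErase]

theorem loopErase_cons (v : V) (l : List V) :
    loopErase (v :: l) = v :: loopErase (l.rtakeWhile (fun u => decide (u ≠ v))) := by
  rw [loopErase]

theorem head?_loopErase (l : List V) : (loopErase l).head? = l.head? := by
  cases l <;> simp [loopErase_nil, loopErase_cons]

theorem loopErase_subset (l : List V) : loopErase l ⊆ l := by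
  induction l using loopErase.induct with
  | case1 => simp [loopErase_nil]
  | case2 v l ih =>
    rw [loopErase_cons]
    exact List.cons_subset_cons v fun x hx => (List.rtakeWhile_suffix _ l).subset (ih hx)

theorem nodup_loopErase (l : List V) : (loopErase l).Nodup := by
  induction l using loopErase.induct with
  | case1 => simp [loopErase_nil]
  | case2 v l ih =>
    rw [loopErase_cons, List.nodup_cons]
    refine ⟨fun h => ?_, ih⟩
    simpa using List.mem_rtakeWhile_imp (loopErase_subset _ h)

theorem List.getLast?_rtakeWhile_of_ne_nil {α : Type*} {p : α → Bool} {l : List α}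
    (h : l.rtakeWhile p ≠ []) : (l.rtakeWhile p).getLast? = l.getLast? := by
  obtain ⟨t, ht⟩ := List.rtakeWhile_suffix p l
  conv_rhs => rw [← ht]
  rw [List.getLast?_append_of_ne_nil _ h]

theorem getLast?_loopErase (l : List V) : (loopErase l).getLast? = l.getLast? := by
  induction l using loopErase.induct with
  | case1 => simp [loopErase_nil]
  | case2 v l ih =>
    rw [loopErase_cons, List.getLast?_cons, List.getLast?_cons, ih]
    -- If nothing follows the last visit to `v`, the path `v :: l` itself ends at `v`.
    by_cases h : l.rtakeWhile (fun u => decide (u ≠ v)) = []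
    · rw [h]
      rcases List.eq_nil_or_concat l with rfl | ⟨l', b, rfl⟩
      · simp
      · have := List.rtakeWhile_eq_nil_iff.mp h (by simp)
        have hb : b = v := by simpa using this
        simp [hb]
    · rw [List.getLast?_rtakeWhile_of_ne_nil h]

theorem List.rtakeWhile_append_of_forall {α : Type*} {p : α → Bool} {c l : List α}
    (hl : ∀ x ∈ l, p x) : (c ++ l).rtakeWhile p = c.rtakeWhile p ++ l := by
  induction l using List.reverseRecOn with
  | nil => simp
  | append_singleton l x ih =>
    rw [← List.append_assoc, List.rtakeWhile_concat_pos _ _ _ (hl x (by simp)),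
      ih fun y hy => hl y (by simp [hy])]
    simp

/-- Splitting a list after the last visit to `v`. -/
def List.splitLast (v : V) :
    List V ≃ {cp : List V × List V // (v :: cp.1).getLast? = some v ∧ v ∉ cp.2} where
  toFun l := ⟨(l.rdropWhile (fun u => decide (u ≠ v)), l.rtakeWhile (fun u => decide (u ≠ v))), by
    refine ⟨?_, fun h => by simpa using List.mem_rtakeWhile_imp h⟩
    by_cases h : l.rdropWhile (fun u => decide (u ≠ v)) = []
    · rw [h]; rfl
    · have := List.rdropWhile_last_not (fun u => decide (u ≠ v)) l h
      rw [List.getLast?_cons, List.getLast?_eq_some_getLast h]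
      simpa using this⟩
  invFun cp := cp.1.1 ++ cp.1.2
  left_inv l := List.rdropWhile_append_rtakeWhile
  right_inv := by
    rintro ⟨⟨c, l⟩, hc, hl⟩
    have h0 : c.rtakeWhile (fun u => decide (u ≠ v)) = [] := by
      rw [List.rtakeWhile_eq_nil_iff]
      intro hne
      rw [List.getLast?_cons, List.getLast?_eq_some_getLast hne] at hc
      simpa using hc
    have h1 : (c ++ l).rtakeWhile (fun u => decide (u ≠ v)) = l := by
      rw [List.rtakeWhile_append_of_forall, h0, List.nil_append]
      intro x hx
      simpa using fun h : x = v => hl (h ▸ hx)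
    have h2 : (c ++ l).rdropWhile (fun u => decide (u ≠ v)) = c := by
      have := @List.rdropWhile_append_rtakeWhile _ (fun u => decide (u ≠ v)) (c ++ l)
      rw [h1] at this
      exact List.append_cancel_right this
    simp only [h1, h2]

end LoopErase

/-! ### Sums of path weights, taken in `ℝ≥0∞` so that they can be rearranged freely. -/

section PathSums

open scoped ENNReal

variable {V : Type*}

theorem ENNReal.tsum_list (f : List V → ℝ≥0∞) :
    ∑' l, f l = f [] + ∑' v, ∑' l, f (v :: l) := by
  let e : Unit ⊕ (V × List V) ≃ List V :=
    { toFun := Sum.elim (fun _ => []) fun x => x.1 :: x.2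
      invFun := fun l => match l with
        | [] => Sum.inl ()
        | v :: l => Sum.inr (v, l)
      left_inv := by rintro (_ | _) <;> rfl
      right_inv := by rintro (_ | _) <;> rfl }
  rw [← e.tsum_eq f, ENNReal.summable.tsum_sum ENNReal.summable, ENNReal.tsum_prod']
  simp [e]

theorem ENNReal.tsum_eq_tsum_length (f : List V → ℝ≥0∞) :
    ∑' l, f l = ∑' k : ℕ, ∑' l : List V, if l.length = k then f l else 0 := by
  rw [ENNReal.tsum_comm]
  simp

theorem ENNReal.tsum_splitLast [DecidableEq V] (v : V) (f : List V → ℝ≥0∞) :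
    ∑' l, f l = ∑' c : List V, ∑' l : List V,
      if (v :: c).getLast? = some v ∧ v ∉ l then f (c ++ l) else 0 := by
  rw [← (List.splitLast v).symm.tsum_eq f, ← ENNReal.tsum_prod]
  refine (tsum_subtype {cp : List V × List V | (v :: cp.1).getLast? = some v ∧ v ∉ cp.2}
    fun cp => f (cp.1 ++ cp.2)).trans ?_
  simp [Set.indicator]

/-- The product of the transition probabilities along a path. -/
noncomputable def pathWeight (P : Matrix V V ℝ) : List V → ℝ≥0∞
  | [] => 1
  | [_] => 1
  | a :: b :: l => ENNReal.ofReal (P a b) * pathWeight P (b :: l)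

theorem pathWeight_append (P : Matrix V V ℝ) (c : List V) {v a : V} (b : V) (l : List V)
    (h : (v :: c).getLast? = some a) :
    pathWeight P (v :: c ++ b :: l) =
      pathWeight P (v :: c) * ENNReal.ofReal (P a b) * pathWeight P (b :: l) := by
  induction c generalizing v with
  | nil =>
    obtain rfl : v = a := by simpa using h
    simp [pathWeight]
  | cons w c ih =>
    rw [List.getLast?_cons_cons] at h
    have := ih h
    simp only [List.cons_append, pathWeight] at this ⊢
    rw [this]
    ring

variable [Fintype V] [DecidableEq V] {P : Matrix V V ℝ}

/-- The expansion of a matrix power as a sum over paths, by conditioning on the first step. -/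
theorem tsum_pathWeight_length (hP : P ∈ Matrix.rowStochastic ℝ V) (A : Finset V) (k : ℕ) {v : V}
    (hv : v ∈ A) (u : V) :
    ∑' c : List V, (if c.length = k then
      if (∀ x ∈ c, x ∈ A) ∧ (v :: c).getLast? = some u then pathWeight P (v :: c) else 0 else 0) =
      ENNReal.ofReal ((killed P A ^ k) v u) := by
  induction k generalizing v with
  | zero =>
    rw [tsum_eq_single ([] : List V) (by intro c hc; simp [hc])]
    by_cases h : v = u <;> simp [pathWeight, h]
  | succ k ih =>
    rw [ENNReal.tsum_list, pow_succ', Matrix.mul_apply, ENNReal.ofReal_sum_of_nonneg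
      fun w _ => mul_nonneg (killed_nonneg hP A v w) (killed_pow_nonneg hP A k w u), tsum_fintype]
    simp only [List.length_nil, (Nat.succ_ne_zero k).symm, if_false, zero_add]
    refine Finset.sum_congr rfl fun w _ => ?_
    rw [ENNReal.ofReal_mul (killed_nonneg hP A v w), killed_apply]
    by_cases hw : w ∈ A
    · rw [← ih hw, ← ENNReal.tsum_mul_left, if_pos ⟨hv, hw⟩]
      refine tsum_congr fun c => ?_
      simp only [List.length_cons, Nat.add_right_cancel_iff, List.forall_mem_cons, hw, true_and,
        List.getLast?_cons_cons, mul_ite, mul_zero, pathWeight]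
    · simp [hw]

theorem tsum_pathWeight_loops (hP : P ∈ Matrix.rowStochastic ℝ V) (hirr : P.IsIrreducible)
    {A : Finset V} (hA : A ≠ Finset.univ) {v : V} (hv : v ∈ A) (u : V) :
    ∑' c : List V, (if (∀ x ∈ c, x ∈ A) ∧ (v :: c).getLast? = some u
      then pathWeight P (v :: c) else 0) = ENNReal.ofReal (green P A v u) := by
  rw [ENNReal.tsum_eq_tsum_length]
  simp_rw [tsum_pathWeight_length hP A _ hv u]
  rw [green, ENNReal.ofReal_tsum_of_nonneg (fun k => killed_pow_nonneg hP A k v u)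
    (summable_killed_pow hP hirr hA v u)]

theorem green_nonneg (hP : P ∈ Matrix.rowStochastic ℝ V) (A : Finset V) (u v : V) :
    0 ≤ green P A u v :=
  tsum_nonneg fun k => killed_pow_nonneg hP A k u v

/-- The total weight of the paths with loop erasure `η` which stay in `A` until their last step. -/
theorem tsum_pathWeight_loopErase (hP : P ∈ Matrix.rowStochastic ℝ V) (hirr : P.IsIrreducible)
    {A : Finset V} (hA : A ≠ Finset.univ) {η : List V} (hne : η ≠ []) (hnd : η.Nodup)
    (hdrop : ∀ x ∈ η.dropLast, x ∈ A) (hlast : ∀ x ∈ η.getLast?, x ∉ A) :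
    ∑' p : List V, (if loopErase p = η ∧ ∀ x ∈ p.dropLast, x ∈ A then pathWeight P p else 0) =
      pathWeight P η * ENNReal.ofReal (loopF P A η.dropLast) := by
  induction η generalizing A with
  | nil => exact absurd rfl hne
  | cons v η ih =>
    cases η with
    | nil =>
      have hv : v ∉ A := hlast v (by simp)
      rw [tsum_eq_single [v]]
      · simp [loopErase_cons, loopErase_nil, loopF]
      · rintro (_ | ⟨a, _ | ⟨b, p⟩⟩) hp
        · simp [loopErase_nil]
        · have : a ≠ v := by simpa using hp
          simp [loopErase_cons, loopErase_nil, this]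
        -- A path with a second vertex would have its first vertex `v` in `A`.
        · rw [if_neg]
          rintro ⟨h1, h2⟩
          have h3 := head?_loopErase (a :: b :: p)
          rw [h1] at h3
          obtain rfl : v = a := by simpa using h3
          exact hv (h2 v (by simp))
    | cons b η =>
      have hv : v ∈ A := hdrop v (by simp)
      have hA' : A.erase v ≠ Finset.univ := by
        intro h
        have := h ▸ Finset.mem_univ v
        simp at this
      rw [List.nodup_cons] at hnd
      have hlast' : ∀ x ∈ (b :: η).getLast?, x ∉ A := by simpa using hlast
      have IH := ih (A := A.erase v) hA' (by simp) hnd.2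
        (fun x hx => Finset.mem_erase.mpr ⟨fun h => hnd.1 (h ▸ List.dropLast_subset _ hx),
          hdrop x (by simp [hx])⟩)
        (fun x hx h => hlast' x hx (Finset.mem_of_mem_erase h))
      rw [ENNReal.tsum_list, tsum_eq_single v]
      -- Cut at the last visit to `v`: `v :: c` is a loop at `v`, and `l` never returns to `v`. The
      -- loops sum to `G_A(v,v)` and `l` is handled by induction in `A.erase v`.
      · rw [if_neg (by simp [loopErase_nil]), zero_add, ENNReal.tsum_splitLast v]
        have hterm : ∀ c l : List V, (if (v :: c).getLast? = some v ∧ v ∉ l then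
            if loopErase (v :: (c ++ l)) = v :: b :: η ∧ ∀ x ∈ (v :: (c ++ l)).dropLast, x ∈ A then
              pathWeight P (v :: (c ++ l)) else 0 else 0) =
            (if (∀ x ∈ c, x ∈ A) ∧ (v :: c).getLast? = some v then pathWeight P (v :: c) else 0) *
            (ENNReal.ofReal (P v b) *
              if loopErase l = b :: η ∧ ∀ x ∈ l.dropLast, x ∈ A.erase v
              then pathWeight P l else 0) := by
          intro c l
          by_cases hc : (v :: c).getLast? = some v
          swap
          · simp [hc]
          -- If `l` visits `v`, the right side vanishes too: `v` cannot occur before the end, where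
          -- `A.erase v` is required, nor at the end, which is the last vertex of `η` and lies
          -- outside `A`.
          by_cases hl : v ∈ l
          · rw [if_neg (by simp [hl])]
            symm
            rw [mul_eq_zero]
            right
            rw [mul_eq_zero]
            right
            rw [if_neg]
            rintro ⟨h1, h2⟩
            have h3 := getLast?_loopErase l
            rw [h1] at h3
            rcases List.eq_nil_or_concat l with rfl | ⟨l', a, rfl⟩
            · simp at hl
            · simp only [List.concat_eq_append, List.mem_append, List.mem_singleton] at hl
              rcases hl with hl | rfl
              · exact (Finset.mem_erase.mp (h2 v (by simpa using hl))).1 rfl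
              · exact hlast' v (by rw [h3]; simp) hv
          have hsplit : loopErase (v :: (c ++ l)) = v :: loopErase l := by
            have h1 := congrArg (fun x => x.1.2)
              ((List.splitLast v).apply_symm_apply ⟨(c, l), hc, hl⟩)
            rw [loopErase_cons]
            exact congrArg (fun x => v :: loopErase x) h1
          rw [if_pos ⟨hc, hl⟩, hsplit]
          by_cases hle : loopErase l = b :: η
          swap
          · simp [hle]
          obtain ⟨l', rfl⟩ : ∃ l', l = b :: l' := by
            cases l with
            | nil => simp [loopErase_nil] at hle
            | cons a l' =>
              rw [loopErase_cons] at hle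
              exact ⟨l', by rw [(List.cons.inj hle).1]⟩
          have hdl : (v :: (c ++ b :: l')).dropLast = v :: (c ++ (b :: l').dropLast) := by
            rw [← List.cons_append, List.dropLast_append_of_ne_nil (by simp), List.cons_append]
          have hcond : (∀ x ∈ (b :: l').dropLast, x ∈ A.erase v) ↔
              ∀ x ∈ (b :: l').dropLast, x ∈ A := by
            refine forall₂_congr fun x hx => ?_
            have : x ≠ v := fun h => hl (h ▸ List.dropLast_subset _ hx)
            simp [this]
          have hpw : pathWeight P (v :: (c ++ b :: l')) = _ := pathWeight_append P c b l' hc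
          simp only [hcond, hdl, hpw, hle, hc, true_and, and_true, List.forall_mem_cons, List.forall_mem_append,
            hv]
          by_cases h1 : ∀ x ∈ c, x ∈ A
          · by_cases h2 : ∀ x ∈ (b :: l').dropLast, x ∈ A
            · rw [if_pos ⟨h1, h2⟩, if_pos h1, if_pos h2, mul_assoc]
            · rw [if_neg fun h => h2 h.2, if_neg h2, mul_zero, mul_zero]
          · rw [if_neg fun h => h1 h.1, if_neg h1, zero_mul]
        simp_rw [hterm, ENNReal.tsum_mul_left]
        rw [ENNReal.tsum_mul_right, tsum_pathWeight_loops hP hirr hA hv, IH]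
        simp only [List.dropLast_cons_cons, loopF, pathWeight]
        rw [ENNReal.ofReal_mul (green_nonneg hP A v v)]
        ring
      · intro a ha
        rw [ENNReal.tsum_eq_zero]
        intro l
        rw [if_neg]
        rintro ⟨h, -⟩
        rw [loopErase_cons] at h
        exact ha (List.cons.inj h).1

end PathSums

/-! ### Trees oriented towards the root. -/

section Trees

variable {V : Type*} {T : SimpleGraph V} {r : V}

theorem IsDirectedEdge.ne_root {u v : V} (h : IsDirectedEdge T r u v) : u ≠ r := by
  rintro rfl
  obtain ⟨h, w, hw⟩ := h
  rw [SimpleGraph.Walk.cons_isPath_iff] at hw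
  exact hw.2 w.end_mem_support

theorem IsDirectedEdge.unique (hT : T.IsTree) {u v v' : V} (h : IsDirectedEdge T r u v)
    (h' : IsDirectedEdge T r u v') : v = v' := by
  obtain ⟨h, w, hw⟩ := h
  obtain ⟨h', w', hw'⟩ := h'
  have := (hT.existsUnique_path u r).unique hw hw'
  cases this
  rfl

theorem exists_isDirectedEdge (hT : T.IsTree) {u : V} (hu : u ≠ r) :
    ∃ v, IsDirectedEdge T r u v := by
  obtain ⟨p, hp, -⟩ := hT.existsUnique_path u r
  cases p with
  | nil => exact absurd rfl hu
  | cons h w => exact ⟨_, h, w, hp⟩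

/-- If the path from `b` to the root meets its neighbour `a`, acyclicity makes `a` its second
vertex; otherwise the edge from `a` can be put in front of it. -/
theorem isDirectedEdge_or (hT : T.IsTree) {a b : V} (h : T.Adj a b) :
    IsDirectedEdge T r a b ∨ IsDirectedEdge T r b a := by
  obtain ⟨p, hp, -⟩ := hT.existsUnique_path b r
  by_cases ha : a ∈ p.support
  · right
    cases p with
    | nil => simp at ha; exact absurd ha h.ne
    | cons h' w =>
      have := hT.isAcyclic.eq_snd_of_adj_start hp h.symm ha
      simp at this
      subst this
      exact ⟨h', w, hp⟩
  · exact Or.inl ⟨h, p, (SimpleGraph.Walk.cons_isPath_iff ..).mpr ⟨hp, ha⟩⟩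

/-- Each vertex other than the root has exactly one outgoing edge, so the tree weight becomes a
product over vertices. -/
theorem exists_parent (hT : T.IsTree) (r : V) :
    ∃ f : V → V, ∀ u v, IsDirectedEdge T r u v ↔ u ≠ r ∧ v = f u := by
  classical
  choose f hf using fun u (hu : u ≠ r) => exists_isDirectedEdge hT hu
  refine ⟨fun u => if hu : u ≠ r then f u hu else u, fun u v => ⟨fun h => ⟨h.ne_root, ?_⟩, ?_⟩⟩
  · simp only [dif_pos h.ne_root]
    exact h.unique hT (hf u h.ne_root)
  · rintro ⟨hu, rfl⟩
    simp only [dif_pos hu]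
    exact hf u hu

theorem treeWeight_eq_prod [Fintype V] [DecidableEq V] (P : Matrix V V ℝ) {f : V → V}
    (hf : ∀ u v, IsDirectedEdge T r u v ↔ u ≠ r ∧ v = f u) :
    treeWeight P r T = ∏ u ∈ Finset.univ.erase r, P u (f u) := by
  classical
  rw [treeWeight]
  symm
  refine Finset.prod_bij (fun u _ => (u, f u)) ?_ ?_ ?_ ?_
  · intro u hu
    simpa [hf] using hu
  · intro u _ v _ h
    exact congrArg Prod.fst h
  · rintro ⟨u, v⟩ h
    simp only [Finset.mem_filter, Finset.mem_univ, true_and, hf] at h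
    exact ⟨u, by simpa using h.1, by rw [h.2]⟩
  · intros; rfl

theorem support_subset_of_closed {B : Finset V}
    (hB : ∀ u v, IsDirectedEdge T r u v → u ∈ B → v ∈ B) {b : V} (p : T.Walk b r) (hp : p.IsPath)
    (hb : b ∈ B) : ∀ x ∈ p.support, x ∈ B := by
  induction p with
  | nil => simpa using hb
  | cons h w ih =>
    have h1 := hp.of_cons
    simp only [SimpleGraph.Walk.support_cons, List.forall_mem_cons]
    exact ⟨hb, ih hB h1 (hB _ _ ⟨h, w, hp⟩ hb)⟩

/-- `η` is a path which ends at its first visit to `B`. -/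
structure EndsAtEntrance (B : Finset V) (η : List V) : Prop where
  dropLast : ∀ x ∈ η.dropLast, x ∉ B
  last : ∃ b ∈ η.getLast?, b ∈ B

theorem EndsAtEntrance.ne_nil {B : Finset V} {η : List V} (h : EndsAtEntrance B η) : η ≠ [] := by
  rintro rfl
  simpa using h.last

theorem endsAtEntrance_singleton {B : Finset V} {b : V} : EndsAtEntrance B [b] ↔ b ∈ B :=
  ⟨fun h => by simpa using h.last, fun h => ⟨by simp, by simpa using h⟩⟩

theorem endsAtEntrance_cons_cons {B : Finset V} {a b : V} {l : List V} :
    EndsAtEntrance B (a :: b :: l) ↔ a ∉ B ∧ EndsAtEntrance B (b :: l) := by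
  constructor
  · intro h
    have h1 := h.dropLast
    simp only [List.dropLast_cons_cons, List.forall_mem_cons] at h1
    exact ⟨h1.1, h1.2, by simpa using h.last⟩
  · rintro ⟨h1, h2⟩
    refine ⟨?_, by simpa using h2.last⟩
    simp only [List.dropLast_cons_cons, List.forall_mem_cons]
    exact ⟨h1, h2.dropLast⟩

/-- Cut the tree path from `v` to the root at its first vertex in `B`. -/
theorem exists_directed_chain {B : Finset V} (hr : r ∈ B) {v : V} (p : T.Walk v r)
    (hp : p.IsPath) : ∃ η : List V, η.head? = some v ∧ η.IsChain (IsDirectedEdge T r) ∧ η.Nodup ∧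
      EndsAtEntrance B η := by
  -- Containment in the path's support is added so that the induction can prove `η` self-avoiding.
  suffices h : ∃ η : List V, η.head? = some v ∧ η.IsChain (IsDirectedEdge T r) ∧ η.Nodup ∧
      EndsAtEntrance B η ∧ η ⊆ p.support by
    obtain ⟨η, h1, h2, h3, h4, -⟩ := h
    exact ⟨η, h1, h2, h3, h4⟩
  induction p with
  | nil => exact ⟨[_], rfl, by simp, by simp, endsAtEntrance_singleton.mpr hr, by simp⟩
  | @cons a b _ h w ih =>
    by_cases ha : a ∈ B
    · exact ⟨[a], rfl, by simp, by simp, endsAtEntrance_singleton.mpr ha, by simp⟩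
    · obtain ⟨η, h1, h2, h3, h4, h5⟩ := ih hr hp.of_cons
      obtain ⟨l, rfl⟩ : ∃ l, η = b :: l := List.head?_eq_some_iff.mp h1
      refine ⟨a :: b :: l, rfl, ?_, ?_, endsAtEntrance_cons_cons.mpr ⟨ha, h4⟩, ?_⟩
      · exact List.isChain_cons_cons.mpr ⟨⟨h, w, hp⟩, h2⟩
      · refine List.nodup_cons.mpr ⟨fun hm => ?_, h3⟩
        rw [SimpleGraph.Walk.cons_isPath_iff] at hp
        exact hp.2 (h5 hm)
      · rw [SimpleGraph.Walk.support_cons]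
        exact List.cons_subset_cons a h5

theorem directed_chain_unique (hT : T.IsTree) {B : Finset V} {η η' : List V}
    (hhead : η.head? = η'.head?) (h : η.IsChain (IsDirectedEdge T r))
    (h' : η'.IsChain (IsDirectedEdge T r)) (hB : EndsAtEntrance B η) (hB' : EndsAtEntrance B η') :
    η = η' := by
  induction η generalizing η' with
  | nil => exact absurd rfl hB.ne_nil
  | cons a l ih =>
    cases η' with
    | nil => exact absurd rfl hB'.ne_nil
    | cons a' l' =>
      obtain rfl : a = a' := by simpa using hhead
      cases l with
      | nil =>
        cases l' with
        | nil => rfl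
        | cons b' l' =>
          exact absurd (endsAtEntrance_singleton.mp hB) (endsAtEntrance_cons_cons.mp hB').1
      | cons b l =>
        cases l' with
        | nil => exact absurd (endsAtEntrance_singleton.mp hB') (endsAtEntrance_cons_cons.mp hB).1
        | cons b' l' =>
          rw [List.isChain_cons_cons] at h h'
          rw [ih (by simpa using h.1.unique hT h'.1) h.2 h'.2 (endsAtEntrance_cons_cons.mp hB).2
            (endsAtEntrance_cons_cons.mp hB').2]

/-- The tree path from the endpoint of `η` to the root stays in the closed set `B`, which `η` meets
only at that endpoint. Joining the two gives a self-avoiding path, so the edges of `η` point to the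
root. -/
theorem directed_chain_of_adj_chain (hT : T.IsTree) {B : Finset V}
    (hB : ∀ u v, IsDirectedEdge T r u v → u ∈ B → v ∈ B) {η : List V} (hη : EndsAtEntrance B η)
    (hnd : η.Nodup) (hadj : η.IsChain T.Adj) : η.IsChain (IsDirectedEdge T r) := by
  obtain ⟨a, l, rfl⟩ := List.exists_cons_of_ne_nil hη.ne_nil
  suffices h : (a :: l).IsChain (IsDirectedEdge T r) ∧
      ∃ p : T.Walk a r, p.IsPath ∧ ∀ x ∈ p.support, x ∈ a :: l ∨ x ∈ B from h.1
  induction l generalizing a with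
  | nil =>
    obtain ⟨p, hp, -⟩ := hT.existsUnique_path a r
    exact ⟨by simp, p, hp, fun x hx =>
      Or.inr (support_subset_of_closed hB p hp (endsAtEntrance_singleton.mp hη) x hx)⟩
  | cons b l ih =>
    rw [List.isChain_cons_cons] at hadj
    rw [List.nodup_cons] at hnd
    rw [endsAtEntrance_cons_cons] at hη
    obtain ⟨h1, p, hp, hsub⟩ := ih b hη.2 hnd.2 hadj.2
    have hcons : (SimpleGraph.Walk.cons hadj.1 p).IsPath := by
      rw [SimpleGraph.Walk.cons_isPath_iff]
      exact ⟨hp, fun h => (hsub a h).elim hnd.1 hη.1⟩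
    refine ⟨List.isChain_cons_cons.mpr ⟨⟨hadj.1, p, hcons⟩, h1⟩, _, hcons, ?_⟩
    simp only [SimpleGraph.Walk.support_cons, List.forall_mem_cons]
    refine ⟨Or.inl (by simp), fun x hx => (hsub x hx).imp (fun h => by simp [h]) id⟩

end Trees

/-! ### Wilson's algorithm for fixed trajectories. -/

section Wilson

open scoped ENNReal

variable {V : Type*}

theorem pathEdges_adj {l : List V} {u v : V} :
    (pathEdges l).Adj u v ↔ u ≠ v ∧ ([u, v] <:+: l ∨ [v, u] <:+: l) := Iff.rfl

theorem pathEdges_singleton (a : V) : pathEdges [a] = ⊥ := by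
  ext u v
  simp only [pathEdges_adj, SimpleGraph.bot_adj, iff_false, not_and, not_or]
  exact fun _ => ⟨fun h => by simpa using h.length_le, fun h => by simpa using h.length_le⟩

theorem pathEdges_cons_cons (a b : V) (l : List V) :
    pathEdges (a :: b :: l) = pathEdges (b :: l) ⊔ SimpleGraph.edge a b := by
  have key : ∀ u v : V, [u, v] <:+: a :: b :: l ↔ (u = a ∧ v = b) ∨ [u, v] <:+: b :: l := by
    intro u v
    rw [List.infix_cons_iff]
    simp
  ext u v
  rw [SimpleGraph.sup_adj, pathEdges_adj, pathEdges_adj, key, key, SimpleGraph.edge_adj]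
  tauto

theorem isChain_adj_of_pathEdges_le {T : SimpleGraph V} {l : List V} (hnd : l.Nodup)
    (h : pathEdges l ≤ T) : l.IsChain T.Adj := by
  induction l with
  | nil => simp
  | cons a l ih =>
    cases l with
    | nil => simp
    | cons b l =>
      rw [pathEdges_cons_cons] at h
      rw [List.nodup_cons] at hnd
      refine List.isChain_cons_cons.mpr ⟨h ?_, ih hnd.2 (le_sup_left.trans h)⟩
      rw [SimpleGraph.sup_adj, SimpleGraph.edge_adj]
      exact Or.inr ⟨Or.inl ⟨rfl, rfl⟩, fun h => hnd.1 (by simp [h])⟩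

variable [DecidableEq V]

/-- A property of partial trees which is kept when a leaf is added is kept when a path is added. -/
theorem invariant_add_path {I : Finset V → SimpleGraph V → Prop} {Q : V → V → Prop}
    (hleaf : ∀ B g a b, I B g → b ∈ B → a ∉ B → Q a b → I (insert a B) (g ⊔ SimpleGraph.edge a b))
    {B : Finset V} {g : SimpleGraph V} (hI : I B g) {η : List V} (hη : EndsAtEntrance B η)
    (hnd : η.Nodup) (hQ : η.IsChain Q) : I (B ∪ η.toFinset) (g ⊔ pathEdges η) := by
  obtain ⟨a, l, rfl⟩ := List.exists_cons_of_ne_nil hη.ne_nil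
  induction l generalizing a with
  | nil =>
    have : B ∪ [a].toFinset = B := by simpa using endsAtEntrance_singleton.mp hη
    rwa [this, pathEdges_singleton, sup_bot_eq]
  | cons b l ih =>
    rw [endsAtEntrance_cons_cons] at hη
    rw [List.nodup_cons] at hnd
    rw [List.isChain_cons_cons] at hQ
    have h := hleaf _ _ a b (ih b hη.2 hnd.2 hQ.2) (by simp)
      (by simpa [hη.1] using hnd.1) hQ.1
    rw [pathEdges_cons_cons, ← sup_assoc]
    convert h using 1
    ext y
    simp only [Finset.mem_union, List.mem_toFinset, Finset.mem_insert, List.mem_cons]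
    tauto

/-- The erasure keeps the last vertex and is self-avoiding, so its other vertices come from the part
of `p` before the entrance. -/
theorem EndsAtEntrance.loopErase {B : Finset V} {p : List V} (h : EndsAtEntrance B p) :
    EndsAtEntrance B (loopErase p) := by
  have hlast := getLast?_loopErase p
  have hnd := nodup_loopErase p
  have hsub := loopErase_subset p
  refine ⟨fun x hx => ?_, by rw [hlast]; exact h.last⟩
  rcases List.eq_nil_or_concat p with rfl | ⟨p', b, rfl⟩
  · exact absurd rfl h.ne_nil
  rcases List.eq_nil_or_concat (_root_.loopErase (p'.concat b)) with h0 | ⟨l, c, hl⟩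
  · rw [h0] at hx
    simp at hx
  rw [hl] at hx hlast hnd hsub
  obtain rfl : c = b := by simpa using hlast
  simp only [List.concat_eq_append, List.dropLast_concat] at hx
  apply h.dropLast
  have hxp : x ∈ p'.concat c := hsub (by simp [hx])
  have hxc : x ≠ c := by
    rintro rfl
    rw [List.concat_eq_append, List.nodup_append] at hnd
    exact hnd.2.2 x hx x (by simp) rfl
  simpa [hxc] using hxp

omit [DecidableEq V] in
theorem endsAtEntrance_pathTo {y : ℕ → V} {B : Finset V} (h : ∃ k, y k ∈ B) :
    EndsAtEntrance B (pathTo y B) := by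
  have hmem : y (sInf {k | y k ∈ B}) ∈ B := Nat.sInf_mem (s := {k | y k ∈ B}) h
  rw [pathTo, List.range_succ, List.map_append]
  refine ⟨fun z hz => ?_, ?_⟩
  · simp only [List.map_cons, List.map_nil, List.dropLast_concat, List.mem_map, List.mem_range] at hz
    obtain ⟨k, hk, rfl⟩ := hz
    exact Nat.notMem_of_lt_sInf hk
  · simpa using hmem

omit [DecidableEq V] in
theorem head?_pathTo (y : ℕ → V) (B : Finset V) : (pathTo y B).head? = some (y 0) := by
  rw [pathTo, List.range_succ_eq_map]
  rfl

variable {n : ℕ} {x : Fin (n + 1) ≃ V}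

theorem wilsonStep_of_univ [Fintype V] (w : Fin n → ℕ → V) {s : WilsonState V}
    (hs : s.connected = Finset.univ) : wilsonStep x w s = s := by
  rw [wilsonStep, dif_neg]
  simp [hs]

-- The index depends on the state alone, not on the trajectories, so the condition imposed at one
-- stage concerns a single walk.
open Classical in
theorem exists_wilsonStep_eq [Fintype V] {s : WilsonState V} (hr : x 0 ∈ s.connected)
    (hs : s.connected ≠ Finset.univ) : ∃ i : Fin n, x i.succ ∉ s.connected ∧
      ∀ w : Fin n → ℕ → V, wilsonStep x w s =
        if ∃ k, w i k ∈ s.connected then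
          ⟨s.connected ∪ (loopErase (pathTo (w i) s.connected)).toFinset,
            s.graph ⊔ pathEdges (loopErase (pathTo (w i) s.connected))⟩
        else s := by
  have hne : (Finset.univ.filter fun i : Fin n => x i.succ ∉ s.connected).Nonempty := by
    by_contra h
    rw [Finset.not_nonempty_iff_eq_empty, Finset.filter_eq_empty_iff] at h
    apply hs
    ext v
    simp only [Finset.mem_univ, iff_true]
    obtain ⟨j, rfl⟩ := x.surjective v
    refine Fin.cases hr (fun i => ?_) j
    simpa using h (Finset.mem_univ i)
  refine ⟨_, (Finset.mem_filter.mp (Finset.min'_mem _ hne)).2, fun w => ?_⟩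
  rw [wilsonStep, dif_pos hne]

theorem graph_le_wilsonStep (w : Fin n → ℕ → V) (s : WilsonState V) :
    s.graph ≤ (wilsonStep x w s).graph := by
  rw [wilsonStep]
  split_ifs
  · dsimp only
    split_ifs
    · exact le_sup_left
    · exact le_rfl
  · exact le_rfl

theorem graph_le_iterate_wilsonStep (w : Fin n → ℕ → V) (m : ℕ) (s : WilsonState V) :
    s.graph ≤ ((wilsonStep x w)^[m] s).graph := by
  induction m generalizing s with
  | zero => exact le_rfl
  | succ m ih => exact (graph_le_wilsonStep w s).trans (ih _)

/-- If all walks visit the root, then Wilson's algorithm outputs a tree. -/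
theorem isTree_wilson [Fintype V] {w : Fin n → ℕ → V} (hw0 : ∀ i, w i 0 = x i.succ)
    (hw : ∀ i, ∃ k, w i k = x 0) : (wilson x w).IsTree := by
  -- Connectedness to the root together with an upper bound on the number of edges: at the end these
  -- characterize a tree, without tracking cycles.
  let I : Finset V → SimpleGraph V → Prop := fun B g =>
    x 0 ∈ B ∧ (∀ v ∈ B, g.Reachable v (x 0)) ∧ g.edgeSet.ncard + 1 ≤ B.card
  have hleaf : ∀ B g a b, I B g → b ∈ B → a ∉ B → True →
      I (insert a B) (g ⊔ SimpleGraph.edge a b) := by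
    rintro B g a b ⟨h0, h1, h2⟩ hb ha -
    have hb' : ∀ v ∈ B, (g ⊔ SimpleGraph.edge a b).Reachable v (x 0) :=
      fun v hv => (h1 v hv).mono le_sup_left
    refine ⟨by simp [h0], ?_, ?_⟩
    · simp only [Finset.forall_mem_insert]
      refine ⟨?_, hb'⟩
      have hadj : (g ⊔ SimpleGraph.edge a b).Adj a b := by
        rw [SimpleGraph.sup_adj, SimpleGraph.edge_adj]
        exact Or.inr ⟨Or.inl ⟨rfl, rfl⟩, fun h => ha (h ▸ hb)⟩
      exact hadj.reachable.trans (hb' b hb)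
    · rw [Finset.card_insert_of_notMem ha]
      have hsub : (g ⊔ SimpleGraph.edge a b).edgeSet ⊆ insert s(a, b) g.edgeSet := by
        rw [SimpleGraph.edgeSet_sup, Set.union_subset_iff]
        refine ⟨Set.subset_insert _ _, ?_⟩
        rw [SimpleGraph.edge, SimpleGraph.edgeSet_fromEdgeSet]
        exact fun e he => Or.inl he.1
      have := Set.ncard_le_ncard hsub (Set.toFinite _)
      have := Set.ncard_insert_le s(a, b) g.edgeSet
      omega
  have main : ∀ (m : ℕ) (s : WilsonState V), s.connectedᶜ.card ≤ m → I s.connected s.graph →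
      I Finset.univ ((wilsonStep x w)^[m] s).graph := by
    intro m
    induction m with
    | zero =>
      intro s hs hI
      have : s.connected = Finset.univ := by
        rw [← compl_compl s.connected, Finset.card_eq_zero.mp (Nat.le_zero.mp hs),
          Finset.compl_empty]
      rwa [this] at hI
    | succ m ih =>
      intro s hs hI
      rw [Function.iterate_succ_apply]
      by_cases hu : s.connected = Finset.univ
      · rw [wilsonStep_of_univ w hu]
        exact ih s (by simp [hu]) hI
      · obtain ⟨i, hi, hstep⟩ := exists_wilsonStep_eq hI.1 hu
        have hhit : ∃ k, w i k ∈ s.connected := by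
          obtain ⟨k, hk⟩ := hw i
          exact ⟨k, hk ▸ hI.1⟩
        rw [hstep w, if_pos hhit]
        set η := loopErase (pathTo (w i) s.connected) with hη
        refine ih _ ?_ (invariant_add_path hleaf hI (endsAtEntrance_pathTo hhit).loopErase
          (nodup_loopErase _) (List.isChain_iff_getElem.mpr fun _ _ => trivial))
        have hmem : x i.succ ∈ η := by
          have := head?_loopErase (pathTo (w i) s.connected)
          rw [head?_pathTo, hw0] at this
          exact List.mem_of_head? this
        have hlt : (s.connected ∪ η.toFinset)ᶜ.card < s.connectedᶜ.card := by
          refine Finset.card_lt_card ((Finset.ssubset_iff_of_subset ?_).mpr ⟨x i.succ, ?_, ?_⟩)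
          · exact Finset.compl_subset_compl.mpr Finset.subset_union_left
          · simpa using hi
          · simp [hmem]
        exact Nat.lt_succ_iff.mp (hlt.trans_le hs)
  have hcard : Fintype.card V = n + 1 := by
    rw [← Fintype.card_congr x, Fintype.card_fin]
  obtain ⟨-, h1, h2⟩ := main n ⟨{x 0}, ⊥⟩ (by simp [Finset.card_compl, hcard])
    ⟨by simp, by simp, by simp⟩
  have hconn : (wilson x w).Connected :=
    { preconnected := fun a b => (h1 a (Finset.mem_univ a)).trans (h1 b (Finset.mem_univ b)).symm
      nonempty := ⟨x 0⟩ }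
  rw [SimpleGraph.isTree_iff_connected_and_card]
  refine ⟨hconn, le_antisymm ?_ hconn.card_vert_le_card_edgeSet_add_one⟩
  rw [Nat.card_eq_fintype_card (α := V)]
  exact h2

/-- The trajectories which visit `B` and whose loop erasure up to that visit is `η`. -/
def loopErasedEvent (B : Finset V) (η : List V) : Set (ℕ → V) :=
  {y | (∃ k, y k ∈ B) ∧ loopErase (pathTo y B) = η}

omit [DecidableEq V] in
theorem pathWeight_of_chain (P : Matrix V V ℝ) {f : V → V} {η : List V}
    (h : η.IsChain fun u v => v = f u) :
    pathWeight P η = (η.dropLast.map fun u => ENNReal.ofReal (P u (f u))).prod := by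
  induction η with
  | nil => simp [pathWeight]
  | cons a l ih =>
    cases l with
    | nil => simp [pathWeight]
    | cons b l =>
      rw [List.isChain_cons_cons] at h
      rw [pathWeight, ih h.2, List.dropLast_cons_cons, List.map_cons, List.prod_cons, ← h.1]

/-- The determinant ratios telescope, which merges the loop factor of one branch with that of the
remaining vertices. -/
theorem loopF_mul_loopF [Fintype V] {P : Matrix V V ℝ} (hP : P ∈ Matrix.rowStochastic ℝ V)
    (hirr : P.IsIrreducible) {A : Finset V} (hA : A ≠ Finset.univ) (l : List V) :
    loopF P A l * loopF P (A \ l.toFinset) (A \ l.toFinset).toList = loopF P A A.toList := by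
  have hA' : A \ l.toFinset ≠ Finset.univ := fun h =>
    hA (Finset.univ_subset_iff.mp (h ▸ Finset.sdiff_subset))
  rw [loopF_eq_det hP hirr hA, loopF_eq_det hP hirr hA, loopF_eq_det hP hirr hA',
    Finset.toList_toFinset, Finset.toList_toFinset, Finset.sdiff_self, Finset.sdiff_self,
    mul_comm, div_mul_div_cancel₀ (det_one_sub_killed_ne_zero hP hirr hA')]

theorem loopF_nonneg [Fintype V] {P : Matrix V V ℝ} (hP : P ∈ Matrix.rowStochastic ℝ V)
    (A : Finset V) (l : List V) : 0 ≤ loopF P A l := by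
  induction l generalizing A with
  | nil => simp [loopF]
  | cons v l ih => exact mul_nonneg (green_nonneg hP A v v) (ih _)

/-- The stage `(B, g)` of Wilson's algorithm can be completed to the tree `T`. -/
structure IsPartOf (T : SimpleGraph V) (r : V) (B : Finset V) (g : SimpleGraph V) : Prop where
  root : r ∈ B
  closed (u v : V) : IsDirectedEdge T r u v → u ∈ B → v ∈ B
  adj_iff (u v : V) : g.Adj u v ↔ (IsDirectedEdge T r u v ∧ u ∈ B) ∨ (IsDirectedEdge T r v u ∧ v ∈ B)

theorem IsPartOf.add_leaf {T : SimpleGraph V} (hT : T.IsTree) {r : V} {B : Finset V}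
    {g : SimpleGraph V} {a b : V} (h : IsPartOf T r B g) (hb : b ∈ B) (ha : a ∉ B)
    (hab : IsDirectedEdge T r a b) : IsPartOf T r (insert a B) (g ⊔ SimpleGraph.edge a b) where
  root := by simp [h.root]
  closed u v huv hu := by
    rcases Finset.mem_insert.mp hu with rfl | hu
    · rw [huv.unique hT hab]
      simp [hb]
    · simp [h.closed u v huv hu]
  adj_iff u v := by
    have hne : a ≠ b := fun e => ha (e ▸ hb)
    have key : ∀ c, IsDirectedEdge T r a c ↔ c = b :=
      fun c => ⟨fun hc => hc.unique hT hab, fun hc => hc ▸ hab⟩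
    rw [SimpleGraph.sup_adj, SimpleGraph.edge_adj, h.adj_iff]
    constructor
    · rintro ((⟨h1, h2⟩ | ⟨h1, h2⟩) | ⟨(⟨rfl, rfl⟩ | ⟨rfl, rfl⟩), h3⟩)
      · exact Or.inl ⟨h1, by simp [h2]⟩
      · exact Or.inr ⟨h1, by simp [h2]⟩
      · exact Or.inl ⟨hab, by simp⟩
      · exact Or.inr ⟨hab, by simp⟩
    · rintro (⟨h1, h2⟩ | ⟨h1, h2⟩)
      · rcases Finset.mem_insert.mp h2 with rfl | h2
        · obtain rfl := (key v).mp h1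
          exact Or.inr ⟨Or.inl ⟨rfl, rfl⟩, hne⟩
        · exact Or.inl (Or.inl ⟨h1, h2⟩)
      · rcases Finset.mem_insert.mp h2 with rfl | h2
        · obtain rfl := (key u).mp h1
          exact Or.inr ⟨Or.inr ⟨rfl, rfl⟩, hne.symm⟩
        · exact Or.inl (Or.inr ⟨h1, h2⟩)

omit [DecidableEq V] in
theorem IsDirectedEdge.adj {T : SimpleGraph V} {r u v : V} (h : IsDirectedEdge T r u v) :
    T.Adj u v := h.1

theorem IsPartOf.graph_eq_iff [Fintype V] {T : SimpleGraph V} (hT : T.IsTree) {r : V}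
    {B : Finset V} {g : SimpleGraph V} (h : IsPartOf T r B g) : g = T ↔ B = Finset.univ := by
  constructor
  · rintro rfl
    by_contra hB
    obtain ⟨v, hv⟩ : ∃ v, v ∉ B := by
      by_contra! h'
      exact hB (Finset.eq_univ_iff_forall.mpr h')
    obtain ⟨u, hu⟩ := exists_isDirectedEdge (r := r) hT fun e : v = r => hv (e ▸ h.root)
    rcases (h.adj_iff v u).mp hu.adj with ⟨-, h2⟩ | ⟨h1, h2⟩
    · exact hv h2
    · exact hv (h.closed _ _ h1 h2)
  · rintro rfl
    ext u v
    rw [h.adj_iff]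
    simp only [Finset.mem_univ, and_true]
    exact ⟨fun h => h.elim (·.adj) (·.adj.symm), isDirectedEdge_or hT⟩

/-- Whether Wilson's algorithm, continued from a part of `T`, outputs `T` is decided by one event
for each of the walks still to be used. -/
theorem exists_events_wilson [Fintype V] {P : Matrix V V ℝ} (hP : P ∈ Matrix.rowStochastic ℝ V)
    (hirr : P.IsIrreducible) {T : SimpleGraph V} (hT : T.IsTree) {f : V → V}
    (hf : ∀ u v, IsDirectedEdge T (x 0) u v ↔ u ≠ x 0 ∧ v = f u)
    {q : Fin n → Set (ℕ → V) → ℝ≥0∞} (hq1 : ∀ i, q i Set.univ = 1)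
    (hq : ∀ (i : Fin n) (B : Finset V) (η : List V), B.Nonempty → η.Nodup → EndsAtEntrance B η →
      η.head? = some (x i.succ) →
      q i (loopErasedEvent B η) = pathWeight P η * ENNReal.ofReal (loopF P Bᶜ η.dropLast))
    (m : ℕ) (s : WilsonState V) (hs : s.connectedᶜ.card ≤ m)
    (hpart : IsPartOf T (x 0) s.connected s.graph) :
    ∃ E : Fin n → Set (ℕ → V),
      (∀ i, E i = Set.univ ∨ ∃ B η, E i = loopErasedEvent B η) ∧
      (∀ i, x i.succ ∈ s.connected → E i = Set.univ) ∧
      (∀ w : Fin n → ℕ → V, (∀ i, w i 0 = x i.succ) →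
        (((wilsonStep x w)^[m] s).graph = T ↔ ∀ i, w i ∈ E i)) ∧
      ∏ i, q i (E i) = (∏ u ∈ s.connectedᶜ, ENNReal.ofReal (P u (f u))) *
        ENNReal.ofReal (loopF P s.connectedᶜ s.connectedᶜ.toList) := by
  induction m generalizing s with
  | zero =>
    have hu : s.connected = Finset.univ := by
      rw [← compl_compl s.connected, Finset.card_eq_zero.mp (Nat.le_zero.mp hs), Finset.compl_empty]
    refine ⟨fun _ => Set.univ, fun _ => Or.inl rfl, fun _ _ => rfl, fun w _ => ?_, ?_⟩
    · simpa using (hpart.graph_eq_iff hT).mpr hu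
    · simp [hu, hq1, loopF]
  | succ m ih =>
    by_cases hu : s.connected = Finset.univ
    · obtain ⟨E, h1, h2, h3, h4⟩ := ih s (by simp [hu]) hpart
      refine ⟨E, h1, h2, fun w hw => ?_, h4⟩
      rw [Function.iterate_succ_apply, wilsonStep_of_univ w hu, h3 w hw]
    obtain ⟨i, hi, hstep⟩ := exists_wilsonStep_eq hpart.root hu
    obtain ⟨p, hp, -⟩ := hT.existsUnique_path (x i.succ) (x 0)
    obtain ⟨η, hη1, hη2, hη3, hη4⟩ := exists_directed_chain hpart.root p hp
    have hmem : x i.succ ∈ η := List.mem_of_head? hη1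
    have hpart' : IsPartOf T (x 0) (s.connected ∪ η.toFinset) (s.graph ⊔ pathEdges η) :=
      invariant_add_path (I := IsPartOf T (x 0)) (fun B g a b h hb ha hab => h.add_leaf hT hb ha hab)
        hpart hη4 hη3 hη2
    have hlt : (s.connected ∪ η.toFinset)ᶜ.card < s.connectedᶜ.card := by
      refine Finset.card_lt_card ((Finset.ssubset_iff_of_subset ?_).mpr ⟨x i.succ, ?_, ?_⟩)
      · exact Finset.compl_subset_compl.mpr Finset.subset_union_left
      · simpa using hi
      · simp [hmem]
    obtain ⟨E, h1, h2, h3, h4⟩ := ih ⟨s.connected ∪ η.toFinset, s.graph ⊔ pathEdges η⟩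
      (Nat.lt_succ_iff.mp (hlt.trans_le hs)) hpart'
    -- Walk `i` must have the branch `η` of `T` as its loop erasure; the other conditions come from
    -- the remaining stages.
    refine ⟨Function.update E i (loopErasedEvent s.connected η), ?_, ?_, ?_, ?_⟩
    · intro j
      by_cases hj : j = i
      · subst hj
        exact Or.inr ⟨_, _, Function.update_self ..⟩
      · rw [Function.update_of_ne hj]
        exact h1 j
    · intro j hj
      have hji : j ≠ i := fun e => hi (e ▸ hj)
      rw [Function.update_of_ne hji]
      exact h2 j (by simp [hj])
    · intro w hw
      -- After this stage the start of walk `i` is connected, so later stages impose nothing on it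
      -- and the update loses no condition.
      have hEi : E i = Set.univ := h2 i (by simp [hmem])
      have hsplit : (∀ j, w j ∈ Function.update E i (loopErasedEvent s.connected η) j) ↔
          w i ∈ loopErasedEvent s.connected η ∧ ∀ j, w j ∈ E j := by
        constructor
        · intro h
          refine ⟨by simpa using h i, fun j => ?_⟩
          by_cases hj : j = i
          · rw [hj, hEi]
            trivial
          · simpa [hj] using h j
        · rintro ⟨h, h'⟩ j
          by_cases hj : j = i
          · subst hj
            simpa using h
          · simpa [hj] using h' j
      rw [hsplit, Function.iterate_succ_apply, hstep w]
      by_cases hhit : ∃ k, w i k ∈ s.connected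
      · rw [if_pos hhit]
        by_cases hle : loopErase (pathTo (w i) s.connected) = η
        · rw [hle, h3 w hw]
          exact ⟨fun h => ⟨⟨hhit, hle⟩, h⟩, fun h => h.2⟩
        -- Edges are never removed, so if the output is `T` the branch just added lies in `T`. It is
        -- then directed to the root, and hence equals the unique directed branch `η`.
        · refine ⟨fun h => absurd ?_ hle, fun h => absurd h.1.2 hle⟩
          have hent := (endsAtEntrance_pathTo hhit).loopErase
          refine directed_chain_unique hT ?_ ?_ hη2 hent hη4
          · rw [head?_loopErase, head?_pathTo, hw, hη1]
          · refine directed_chain_of_adj_chain hT hpart.closed hent (nodup_loopErase _)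
              (isChain_adj_of_pathEdges_le (nodup_loopErase _) ?_)
            conv_rhs => rw [← h]
            exact le_trans le_sup_right (graph_le_iterate_wilsonStep w m
              (⟨_, s.graph ⊔ pathEdges (loopErase (pathTo (w i) s.connected))⟩ : WilsonState V))
      · rw [if_neg hhit]
        -- A walk that misses the connected set stalls the algorithm at an incomplete graph, which
        -- is not `T`.
        have hfix : wilsonStep x w s = s := by rw [hstep w, if_neg hhit]
        rw [Function.iterate_fixed hfix]
        refine ⟨fun h => absurd ((hpart.graph_eq_iff hT).mp h) hu, fun h => absurd h.1.1 hhit⟩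
    · have hEi : E i = Set.univ := h2 i (by simp [hmem])
      have hprod : ∏ j, q j (Function.update E i (loopErasedEvent s.connected η) j) =
          q i (loopErasedEvent s.connected η) * ∏ j, q j (E j) := by
        rw [← Finset.mul_prod_erase _ _ (Finset.mem_univ i),
          ← Finset.mul_prod_erase _ (fun j => q j (E j)) (Finset.mem_univ i)]
        simp only [Function.update_self, hEi, hq1, one_mul]
        congr 1
        refine Finset.prod_congr rfl fun j hj => ?_
        rw [Function.update_of_ne (Finset.ne_of_mem_erase hj)]
      -- The last vertex of `η` was already connected, so only `η.dropLast` is new.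
      have hcompl : (s.connected ∪ η.toFinset)ᶜ = s.connectedᶜ \ η.dropLast.toFinset := by
        rcases List.eq_nil_or_concat η with rfl | ⟨l, b, rfl⟩
        · simp
        · have hb : b ∈ s.connected := by simpa using hη4.last
          ext a
          simp only [Finset.mem_compl, Finset.mem_union, Finset.mem_sdiff, List.mem_toFinset,
            List.concat_eq_append, List.dropLast_concat, List.mem_append, List.mem_singleton]
          have : a = b → a ∈ s.connected := fun e => e ▸ hb
          tauto
      have hsub : η.dropLast.toFinset ⊆ s.connectedᶜ := by
        intro a ha
        simpa using hη4.dropLast a (by simpa using ha)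
      have hne : s.connectedᶜ ≠ Finset.univ := by
        intro h
        have := h ▸ Finset.mem_univ (x 0)
        simp [hpart.root] at this
      have hchain : η.IsChain fun u v => v = f u := hη2.imp fun u v h => ((hf u v).mp h).2
      rw [hprod, h4, hq i _ η ⟨_, hpart.root⟩ hη3 hη4 hη1, pathWeight_of_chain P hchain,
        ← List.prod_toFinset _ (hη3.sublist (List.dropLast_sublist η)), hcompl,
        ← loopF_mul_loopF hP hirr hne η.dropLast, ENNReal.ofReal_mul (loopF_nonneg hP _ _),
        ← Finset.prod_sdiff hsub]
      ring

end Wilson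

/-! ### The law of the output. -/

section Law

open scoped ENNReal

variable {V : Type*}

theorem pathWeight_map_range {P : Matrix V V ℝ} (hP : ∀ u v, 0 ≤ P u v) (a : ℕ → V) (m : ℕ) :
    pathWeight P ((List.range (m + 1)).map a) =
      ENNReal.ofReal (∏ k ∈ Finset.range m, P (a k) (a (k + 1))) := by
  induction m generalizing a with
  | zero => simp [pathWeight]
  | succ m ih =>
    have h1 : (List.range (m + 1 + 1)).map a =
        a 0 :: (List.range (m + 1)).map fun k => a (k + 1) := by
      rw [List.range_succ_eq_map, List.map_cons, List.map_map]
      rfl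
    have h2 : (List.range (m + 1)).map (fun k => a (k + 1)) =
        a 1 :: (List.range m).map fun k => a (k + 2) := by
      rw [List.range_succ_eq_map, List.map_cons, List.map_map]
      rfl
    rw [h1, h2, pathWeight, ← h2, ih, Finset.prod_range_succ', mul_comm,
      ENNReal.ofReal_mul (Finset.prod_nonneg fun _ _ => hP _ _)]

/-- The trajectories which start with the path `p`. -/
def pathCylinder (p : List V) : Set (ℕ → V) :=
  {y | (List.range p.length).map y = p}

theorem measurableSet_pathCylinder [MeasurableSpace V] [MeasurableSingletonClass V] (p : List V) :
    MeasurableSet (pathCylinder p) := by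
  have : pathCylinder p = ⋂ k : Fin p.length, (fun y : ℕ → V => y k) ⁻¹' {p[k]} := by
    ext y
    simp only [pathCylinder, Set.mem_ofPred_eq, Set.mem_iInter, Set.mem_preimage,
      Set.mem_singleton_iff, List.ext_getElem_iff, List.length_map, List.length_range, true_and,
      List.getElem_map, List.getElem_range]
    exact ⟨fun h k => h k k.2 k.2, fun h k hk _ => h ⟨k, hk⟩⟩
  rw [this]
  exact MeasurableSet.iInter fun k => measurable_pi_apply _ (measurableSet_singleton _)

theorem mem_pathCylinder_iff {B : Finset V} {p : List V} (hp : EndsAtEntrance B p) (y : ℕ → V) :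
    y ∈ pathCylinder p ↔ (∃ k, y k ∈ B) ∧ pathTo y B = p := by
  constructor
  · intro h
    change (List.range p.length).map y = p at h
    obtain ⟨m, hm⟩ : ∃ m, p.length = m + 1 :=
      Nat.exists_eq_succ_of_ne_zero fun h0 => hp.ne_nil (List.length_eq_zero_iff.mp h0)
    rw [hm] at h
    rw [← h] at hp
    have hlast : y m ∈ B := by
      have := hp.last
      rw [List.range_succ, List.map_append] at this
      simpa using this
    have hdrop : ∀ k < m, y k ∉ B := by
      intro k hk
      apply hp.dropLast
      rw [List.range_succ, List.map_append]
      simp only [List.map_cons, List.map_nil, List.dropLast_concat, List.mem_map, List.mem_range]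
      exact ⟨k, hk, rfl⟩
    have hinf : sInf {k | y k ∈ B} = m :=
      le_antisymm (Nat.sInf_le hlast) (le_csInf ⟨m, hlast⟩ fun k hk => by
        by_contra hlt
        exact hdrop k (not_le.mp hlt) hk)
    exact ⟨⟨m, hlast⟩, by rw [pathTo, hinf, h]⟩
  · rintro ⟨-, rfl⟩
    simp [pathCylinder, pathTo]

/-- The trajectory up to its entrance into `B` determines the event, and there are countably many
such paths when `V` is countable. -/
theorem loopErasedEvent_eq_iUnion [DecidableEq V] (B : Finset V) (η : List V) :
    loopErasedEvent B η =
      ⋃ p : {p : List V | loopErase p = η ∧ EndsAtEntrance B p}, pathCylinder p.1 := by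
  ext y
  rw [Set.mem_iUnion]
  constructor
  · rintro ⟨h1, h2⟩
    exact ⟨⟨_, h2, endsAtEntrance_pathTo h1⟩,
      (mem_pathCylinder_iff (endsAtEntrance_pathTo h1) y).mpr ⟨h1, rfl⟩⟩
  · rintro ⟨⟨p, h1, h2⟩, h3⟩
    obtain ⟨h4, rfl⟩ := (mem_pathCylinder_iff h2 y).mp h3
    exact ⟨h4, h1⟩

variable [DecidableEq V] [MeasurableSpace V] [MeasurableSingletonClass V]

theorem measurableSet_loopErasedEvent [Countable V] (B : Finset V) (η : List V) :
    MeasurableSet (loopErasedEvent B η) := by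
  rw [loopErasedEvent_eq_iUnion]
  exact MeasurableSet.iUnion fun p => measurableSet_pathCylinder _

variable {Ω : Type*} [MeasurableSpace Ω] {μ : Measure Ω} {P : Matrix V V ℝ} {v : V}
  {S : ℕ → Ω → V}

omit [MeasurableSingletonClass V] in
theorem IsMarkovChainFrom.measurable_path (h : IsMarkovChainFrom μ P v S) :
    Measurable fun ω k => S k ω :=
  measurable_pi_lambda _ h.measurable

omit [MeasurableSingletonClass V] in
theorem IsMarkovChainFrom.measure_pathCylinder (h : IsMarkovChainFrom μ P v S)
    (hP : ∀ u v, 0 ≤ P u v) {p : List V} (hp : p.head? = some v) :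
    μ ((fun ω k => S k ω) ⁻¹' pathCylinder p) = pathWeight P p := by
  obtain ⟨l, rfl⟩ := List.head?_eq_some_iff.mp hp
  have hmap : (List.range (l.length + 1)).map (fun k => (v :: l).getD k v) = v :: l := by
    apply List.ext_getElem (by simp)
    intro k h1 h2
    simp only [List.getElem_map, List.getElem_range]
    rw [List.getD_eq_getElem _ _ h2]
  have hset : (fun ω k => S k ω) ⁻¹' pathCylinder (v :: l) =
      {ω | ∀ k ≤ l.length, S k ω = (v :: l).getD k v} := by
    ext ω
    simp only [pathCylinder, Set.mem_preimage, Set.mem_ofPred_eq, List.length_cons]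
    conv_lhs => rhs; rw [← hmap]
    rw [List.map_inj_left]
    simp only [List.mem_range, Nat.lt_succ_iff]
  rw [hset, h.law, if_pos (by simp), ← pathWeight_map_range hP, hmap]

theorem IsMarkovChainFrom.ae_zero [IsProbabilityMeasure μ]
    (h : IsMarkovChainFrom μ P v S) : ∀ᵐ ω ∂μ, S 0 ω = v := by
  refine (mem_ae_iff_prob_eq_one (h.measurable 0 (measurableSet_singleton v))).mpr ?_
  simpa [Set.preimage] using h.law 0 fun _ => v

variable [Fintype V]

/-- The cylinders are disjoint because a trajectory has only one initial path ending at its first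
entrance; their measures are the path weights summed in `tsum_pathWeight_loopErase`. -/
theorem IsMarkovChainFrom.measure_loopErasedEvent (h : IsMarkovChainFrom μ P v S)
    (hP : P ∈ Matrix.rowStochastic ℝ V) (hirr : P.IsIrreducible) {B : Finset V} (hB : B.Nonempty)
    {η : List V} (hnd : η.Nodup) (hη : EndsAtEntrance B η) (hhead : η.head? = some v) :
    μ ((fun ω k => S k ω) ⁻¹' loopErasedEvent B η) =
      pathWeight P η * ENNReal.ofReal (loopF P Bᶜ η.dropLast) := by
  have hne : Bᶜ ≠ Finset.univ := by
    obtain ⟨b, hb⟩ := hB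
    intro h
    have := h ▸ Finset.mem_univ b
    simp [hb] at this
  rw [← tsum_pathWeight_loopErase hP hirr hne hη.ne_nil hnd
    (fun x hx => Finset.mem_compl.mpr (hη.dropLast x hx)), loopErasedEvent_eq_iUnion,
    Set.preimage_iUnion, measure_iUnion]
  · have hval : ∀ p : {p : List V | loopErase p = η ∧ EndsAtEntrance B p},
        μ ((fun ω k => S k ω) ⁻¹' pathCylinder p.1) = pathWeight P p.1 := by
      rintro ⟨p, hp1, hp2⟩
      refine h.measure_pathCylinder (fun u v => hirr.nonneg u v) ?_
      rw [← head?_loopErase, hp1, hhead]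
    simp_rw [hval]
    refine (tsum_subtype {p : List V | loopErase p = η ∧ EndsAtEntrance B p}
      fun p => pathWeight P p).trans (tsum_congr fun p => ?_)
    classical
    rw [Set.indicator_apply]
    refine if_congr ?_ rfl rfl
    simp only [Set.mem_ofPred_eq, Finset.mem_compl]
    refine and_congr_right fun hp => ⟨fun h => h.dropLast, fun h => ⟨h, ?_⟩⟩
    rw [← getLast?_loopErase, hp]
    exact hη.last
  · rintro ⟨p, hp1, hp2⟩ ⟨p', hp1', hp2'⟩ hpp'
    refine Set.disjoint_left.mpr fun ω h1 h2 => hpp' ?_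
    have h3 := ((mem_pathCylinder_iff hp2 _).mp h1).2
    have h4 := ((mem_pathCylinder_iff hp2' _).mp h2).2
    exact Subtype.ext (h3.symm.trans h4)
  · exact fun p => h.measurable_path (measurableSet_pathCylinder _)
  · intro x hx
    obtain ⟨b, hb, hbB⟩ := hη.last
    obtain rfl : b = x := by
      rw [Option.mem_def] at hb hx
      exact Option.some.inj (hb.symm.trans hx)
    simpa using hbB

theorem IsMarkovChainFrom.ae_exists_mem [IsProbabilityMeasure μ] (h : IsMarkovChainFrom μ P v S)
    (hP : P ∈ Matrix.rowStochastic ℝ V) (hirr : P.IsIrreducible) {r : V} (hv : v ≠ r) :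
    ∀ᵐ ω ∂μ, ∃ k, S k ω = r := by
  set A := Finset.univ.erase r with hAdef
  have hA : A ≠ Finset.univ := fun h => by
    have := h ▸ Finset.mem_univ r
    simp [hAdef] at this
  have hvA : v ∈ A := by simp [hAdef, hv]
  rw [ae_iff]
  -- A walk avoiding `r` stays in `A` for `m` steps, which has probability at most the row sum of
  -- `P_A ^ m`. This tends to zero, being a finite sum of terms of convergent series.
  have hbound : ∀ m : ℕ, μ {ω | ¬ ∃ k, S k ω = r} ≤
      ∑ u, ENNReal.ofReal ((killed P A ^ m) v u) := by
    intro m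
    have hsub : {ω | ¬ ∃ k, S k ω = r} ⊆ {ω | ¬ S 0 ω = v} ∪
        ⋃ c : {c : List V | c.length = m ∧ ∀ x ∈ c, x ∈ A},
          (fun ω k => S k ω) ⁻¹' pathCylinder (v :: c.1) := by
      intro ω hω
      by_cases h0 : S 0 ω = v
      swap
      · exact Or.inl h0
      right
      rw [Set.mem_iUnion]
      refine ⟨⟨(List.range m).map fun k => S (k + 1) ω, by simp, ?_⟩, ?_⟩
      · simp only [List.mem_map, List.mem_range, forall_exists_index, and_imp,
          forall_apply_eq_imp_iff₂, hAdef, Finset.mem_erase, Finset.mem_univ, and_true]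
        exact fun k _ hk => hω ⟨_, hk⟩
      · simp only [Set.mem_preimage, pathCylinder, Set.mem_ofPred_eq, List.length_cons,
          List.length_map, List.length_range]
        rw [List.range_succ_eq_map, List.map_cons, List.map_map, h0]
        rfl
    refine (measure_mono hsub).trans ((measure_union_le _ _).trans ?_)
    rw [ae_iff.mp h.ae_zero, zero_add]
    refine (measure_iUnion_le _).trans ?_
    simp_rw [h.measure_pathCylinder (fun u v => hirr.nonneg u v) (p := v :: _) rfl]
    rw [← tsum_fintype (L := SummationFilter.unconditional V)]
    simp_rw [← tsum_pathWeight_length hP A m hvA]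
    rw [ENNReal.tsum_comm]
    refine ((tsum_subtype {c : List V | c.length = m ∧ ∀ x ∈ c, x ∈ A}
      fun c => pathWeight P (v :: c)).trans_le (ENNReal.tsum_le_tsum fun c => ?_))
    by_cases hc : c ∈ {c : List V | c.length = m ∧ ∀ x ∈ c, x ∈ A}
    · obtain ⟨u, hu⟩ : ∃ u, (v :: c).getLast? = some u := ⟨_, List.getLast?_cons⟩
      rw [Set.indicator_of_mem hc]
      refine le_trans (le_of_eq ?_) (ENNReal.le_tsum u)
      rw [if_pos hc.1, if_pos ⟨hc.2, hu⟩]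
    · rw [Set.indicator_of_notMem hc]
      exact zero_le
  have hlim : Filter.Tendsto (fun m : ℕ => ∑ u, ENNReal.ofReal ((killed P A ^ m) v u))
      Filter.atTop (nhds 0) := by
    have : (0 : ℝ≥0∞) = ∑ u : V, ENNReal.ofReal 0 := by simp
    rw [this]
    exact tendsto_finsetSum _ fun u _ =>
      ENNReal.tendsto_ofReal (summable_killed_pow hP hirr hA v u).tendsto_atTop_zero
  exact le_antisymm (ge_of_tendsto' hlim hbound) (zero_le)

variable {n : ℕ} {x : Fin (n + 1) ≃ V} [IsProbabilityMeasure μ] {W : Fin n → ℕ → Ω → V}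

theorem ae_wilson_mem_spanningTrees (hP : P ∈ Matrix.rowStochastic ℝ V) (hirr : P.IsIrreducible)
    (hW : ∀ i, IsMarkovChainFrom μ P (x i.succ) (W i)) :
    ∀ᵐ ω ∂μ, wilson x (fun i k => W i k ω) ∈ spanningTrees (⊤ : SimpleGraph V) := by
  have h0 : ∀ᵐ ω ∂μ, ∀ i, W i 0 ω = x i.succ := ae_all_iff.mpr fun i => (hW i).ae_zero
  have h1 : ∀ᵐ ω ∂μ, ∀ i, ∃ k, W i k ω = x 0 := ae_all_iff.mpr fun i =>
    (hW i).ae_exists_mem hP hirr (x.injective.ne (Fin.succ_ne_zero i))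
  filter_upwards [h0, h1] with ω hω0 hω1
  rw [spanningTrees, Set.Finite.mem_toFinset]
  exact ⟨le_top, isTree_wilson hω0 hω1⟩

theorem exists_events_wilson_eq (hP : P ∈ Matrix.rowStochastic ℝ V) (hirr : P.IsIrreducible)
    (hW : ∀ i, IsMarkovChainFrom μ P (x i.succ) (W i))
    {T : SimpleGraph V} (hT : T.IsTree) :
    ∃ E : Fin n → Set (ℕ → V), (∀ i, MeasurableSet (E i)) ∧
      (∀ w : Fin n → ℕ → V, (∀ i, w i 0 = x i.succ) → (wilson x w = T ↔ ∀ i, w i ∈ E i)) ∧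
      ∏ i, μ ((fun ω k => W i k ω) ⁻¹' E i) = ENNReal.ofReal (treeWeight P (x 0) T *
        loopF P (Finset.univ.erase (x 0)) (Finset.univ.erase (x 0)).toList) := by
  obtain ⟨f, hf⟩ := exists_parent hT (x 0)
  have hcard : Fintype.card V = n + 1 := by
    rw [← Fintype.card_congr x, Fintype.card_fin]
  obtain ⟨E, h1, -, h3, h4⟩ := exists_events_wilson (x := x) hP hirr hT hf
    (q := fun i E => μ ((fun ω k => W i k ω) ⁻¹' E)) (by simp)
    (fun i B η hB hnd hη hhead => (hW i).measure_loopErasedEvent hP hirr hB hnd hη hhead)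
    n ⟨{x 0}, ⊥⟩ (by simp [Finset.card_compl, hcard])
    { root := by simp
      closed := fun u v huv hu => absurd (by simpa using hu) huv.ne_root
      adj_iff := fun u v => by
        simp only [SimpleGraph.bot_adj, Finset.mem_singleton, false_iff, not_or, not_and]
        exact ⟨fun h => h.ne_root, fun h => h.ne_root⟩ }
  refine ⟨E, fun i => ?_, h3, ?_⟩
  · rcases h1 i with h | ⟨B, η, h⟩
    · rw [h]
      exact MeasurableSet.univ
    · rw [h]
      exact measurableSet_loopErasedEvent B η
  · rw [h4, treeWeight_eq_prod P hf, ENNReal.ofReal_mul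
      (Finset.prod_nonneg fun u _ => hirr.nonneg u _),
      ENNReal.ofReal_prod_of_nonneg fun u _ => hirr.nonneg u _]
    have : ({x 0} : Finset V)ᶜ = Finset.univ.erase (x 0) := by
      ext a
      simp
    rw [this]

/-- The description by events is valid only for walks with the prescribed starting points, hence
almost surely; this yields null measurability, which is enough for additivity. -/
theorem measure_wilson_eq (hP : P ∈ Matrix.rowStochastic ℝ V) (hirr : P.IsIrreducible)
    (hW : ∀ i, IsMarkovChainFrom μ P (x i.succ) (W i))
    (hind : iIndepFun (fun (i : Fin n) (ω : Ω) (k : ℕ) => W i k ω) μ)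
    {T : SimpleGraph V} (hT : T.IsTree) :
    NullMeasurableSet {ω | wilson x (fun i k => W i k ω) = T} μ ∧
    μ {ω | wilson x (fun i k => W i k ω) = T} = ENNReal.ofReal (treeWeight P (x 0) T *
      loopF P (Finset.univ.erase (x 0)) (Finset.univ.erase (x 0)).toList) := by
  obtain ⟨E, hmeas, hE, hprod⟩ := exists_events_wilson_eq hP hirr hW hT
  have h0 : ∀ᵐ ω ∂μ, ∀ i, W i 0 ω = x i.succ := ae_all_iff.mpr fun i => (hW i).ae_zero
  have hmul := hind.measure_inter_preimage_eq_mul Finset.univ (sets := E) fun i _ => hmeas i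
  have hae : (⋂ i ∈ Finset.univ, (fun ω k => W i k ω) ⁻¹' E i) =ᵐ[μ]
      {ω | wilson x (fun i k => W i k ω) = T} := by
    filter_upwards [h0] with ω hω
    refine propext (Iff.trans ?_ (hE (fun i k => W i k ω) hω).symm)
    change ω ∈ ⋂ i ∈ Finset.univ, (fun ω k => W i k ω) ⁻¹' E i ↔ _
    simp
  refine ⟨NullMeasurableSet.congr ?_ hae, ?_⟩
  · exact (Finset.measurableSet_biInter _ fun i _ =>
      (hW i).measurable_path (hmeas i)).nullMeasurableSet
  · rw [← hprod, ← hmul]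
    exact measure_congr hae.symm

end Law

/-! ### Constructing independent chains, and the sum over trees. -/

section Existence

open scoped ENNReal

variable {V : Type*} [Fintype V] [MeasurableSpace V]

/-- The law of one step of the chain from `u`. -/
noncomputable def stepMeasure (P : Matrix V V ℝ) (u : V) : Measure V :=
  ∑ w, ENNReal.ofReal (P u w) • Measure.dirac w

theorem stepMeasure_singleton [MeasurableSingletonClass V] (P : Matrix V V ℝ) (u w : V) :
    stepMeasure P u {w} = ENNReal.ofReal (P u w) := by
  classical
  simp [stepMeasure, Measure.finsetSum_apply, Set.indicator_apply]

variable [DecidableEq V]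

theorem isProbabilityMeasure_stepMeasure {P : Matrix V V ℝ} (hP : P ∈ Matrix.rowStochastic ℝ V)
    (u : V) : IsProbabilityMeasure (stepMeasure P u) := by
  constructor
  simp only [stepMeasure, Measure.finsetSum_apply, Measure.smul_apply, measure_univ, smul_eq_mul,
    mul_one]
  rw [← ENNReal.ofReal_sum_of_nonneg fun _ _ => Matrix.nonneg_of_mem_rowStochastic hP,
    Matrix.sum_row_of_mem_rowStochastic hP, ENNReal.ofReal_one]

/-- The chain from `v` driven by the moves `φ`, where `φ (k, u)` is the move from `u` at
time `k`. -/
def drivenChain (v : V) : ℕ → (ℕ × V → V) → V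
  | 0, _ => v
  | k + 1, φ => φ (k, drivenChain v k φ)

variable [MeasurableSingletonClass V]

omit [DecidableEq V] in
theorem measurable_drivenChain (v : V) (k : ℕ) : Measurable (drivenChain v k) := by
  induction k with
  | zero => exact measurable_const
  | succ k ih =>
    have h : Measurable fun p : V × (ℕ × V → V) => p.2 (k, p.1) :=
      measurable_from_prod_countable_right fun u => measurable_pi_apply (k, u)
    exact h.comp (ih.prodMk measurable_id)

theorem isMarkovChainFrom_drivenChain {P : Matrix V V ℝ} (hP : P ∈ Matrix.rowStochastic ℝ V)
    (v : V) :
    IsMarkovChainFrom (Measure.infinitePi fun ku : ℕ × V => stepMeasure P ku.2) P v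
      (drivenChain v) where
  measurable k := measurable_drivenChain v k
  law m a := by
    have := isProbabilityMeasure_stepMeasure hP
    split_ifs with h0
    -- Following `a` constrains one move at each time. The coordinates `(k, a k)` are distinct
    -- because their times are, so the event is a finite box of the product measure.
    · have hset : {φ : ℕ × V → V | ∀ k ≤ m, drivenChain v k φ = a k} =
          Set.pi ((Finset.range m).image fun k => (k, a k)) fun ku => {a (ku.1 + 1)} := by
        ext φ
        simp only [Set.mem_ofPred_eq, Set.mem_pi, Finset.coe_image, Set.mem_image,
          Finset.coe_range, Set.mem_Iio, forall_exists_index, and_imp,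
          forall_apply_eq_imp_iff₂, Set.mem_singleton_iff]
        constructor
        · intro h k hk
          rw [← h k hk.le, ← h (k + 1) hk, drivenChain]
        · intro h k
          induction k with
          | zero => exact fun _ => h0.symm
          | succ k ih =>
            intro hk
            rw [drivenChain, ih (by omega), h k (by omega)]
      rw [hset, Measure.infinitePi_pi _ fun _ _ => measurableSet_singleton _,
        Finset.prod_image fun k _ l _ h => congrArg Prod.fst h,
        ENNReal.ofReal_prod_of_nonneg fun _ _ => Matrix.nonneg_of_mem_rowStochastic hP]
      simp_rw [stepMeasure_singleton]
    · rw [show {φ : ℕ × V → V | ∀ k ≤ m, drivenChain v k φ = a k} = ∅ from ?_, measure_empty]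
      rw [Set.eq_empty_iff_forall_notMem]
      exact fun φ h => h0 (h 0 (Nat.zero_le m)).symm

/-- A deterministic identity obtained by realizing the chains on a product space: the disjoint
events "the output is `T`" exhaust it up to a null set. -/
theorem sum_treeWeight_mul_loopF {n : ℕ} (x : Fin (n + 1) ≃ V) {P : Matrix V V ℝ}
    (hP : P ∈ Matrix.rowStochastic ℝ V) (hirr : P.IsIrreducible) :
    ∑ T ∈ spanningTrees (⊤ : SimpleGraph V), treeWeight P (x 0) T *
      loopF P (Finset.univ.erase (x 0)) (Finset.univ.erase (x 0)).toList = 1 := by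
  have := isProbabilityMeasure_stepMeasure hP
  let ν := Measure.infinitePi fun ku : ℕ × V => stepMeasure P ku.2
  let μ : Measure (Fin n → ℕ × V → V) := Measure.pi fun _ => ν
  let W : Fin n → ℕ → (Fin n → ℕ × V → V) → V := fun i k ω => drivenChain (x i.succ) k (ω i)
  have hW : ∀ i, IsMarkovChainFrom μ P (x i.succ) (W i) := fun i =>
    { measurable := fun k => (measurable_drivenChain _ k).comp (measurable_pi_apply i)
      law := fun m a => by
        have hpre := (measurePreserving_eval (fun _ : Fin n => ν) i).measure_preimage
          (s := {φ | ∀ k ≤ m, drivenChain (x i.succ) k φ = a k}) (by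
            have : {φ : ℕ × V → V | ∀ k ≤ m, drivenChain (x i.succ) k φ = a k} =
                ⋂ k ∈ Set.Iic m, drivenChain (x i.succ) k ⁻¹' {a k} := by
              ext φ
              simp
            rw [this]
            exact (MeasurableSet.biInter (Set.to_countable _) fun k _ =>
              measurable_drivenChain _ k (measurableSet_singleton _)).nullMeasurableSet)
        exact hpre.trans ((isMarkovChainFrom_drivenChain hP (x i.succ)).law m a) }
  have hind : iIndepFun (fun (i : Fin n) (ω : Fin n → ℕ × V → V) (k : ℕ) => W i k ω) μ :=
    iIndepFun_pi (μ := fun _ : Fin n => ν)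
      (X := fun (i : Fin n) φ (k : ℕ) => drivenChain (x i.succ) k φ) fun i =>
      (measurable_pi_lambda _ fun k => measurable_drivenChain _ k).aemeasurable
  have htree : ∀ T ∈ spanningTrees (⊤ : SimpleGraph V), T.IsTree := fun T hT =>
    ((Set.Finite.mem_toFinset _).mp hT).2
  have hnonneg : ∀ T : SimpleGraph V, 0 ≤ treeWeight P (x 0) T *
      loopF P (Finset.univ.erase (x 0)) (Finset.univ.erase (x 0)).toList := fun T =>
    mul_nonneg (Finset.prod_nonneg fun _ _ => hirr.nonneg _ _) (loopF_nonneg hP _ _)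
  have hsum : ENNReal.ofReal (∑ T ∈ spanningTrees (⊤ : SimpleGraph V), treeWeight P (x 0) T *
      loopF P (Finset.univ.erase (x 0)) (Finset.univ.erase (x 0)).toList) = 1 := by
    rw [ENNReal.ofReal_sum_of_nonneg fun T _ => hnonneg T,
      Finset.sum_congr rfl fun T hT => (measure_wilson_eq hP hirr hW hind (htree T hT)).2.symm,
      ← measure_biUnion_finset₀]
    · rw [← measure_univ (μ := μ)]
      refine measure_congr ?_
      filter_upwards [ae_wilson_mem_spanningTrees hP hirr hW] with ω hω
      refine propext ⟨fun _ => trivial, fun _ => ?_⟩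
      exact Set.mem_biUnion (x := wilson x fun i k => W i k ω) hω rfl
    · intro T _ T' _ hne
      exact (Set.disjoint_left.mpr fun ω h h' => hne (h.symm.trans h')).aedisjoint
    · exact fun T hT => (measure_wilson_eq hP hirr hW hind (htree T hT)).1
  rwa [ENNReal.ofReal_eq_one] at hsum

theorem sum_treeWeight_eq_det {n : ℕ} (x : Fin (n + 1) ≃ V) {P : Matrix V V ℝ}
    (hP : P ∈ Matrix.rowStochastic ℝ V) (hirr : P.IsIrreducible) :
    ∑ T ∈ spanningTrees (⊤ : SimpleGraph V), treeWeight P (x 0) T =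
      (1 - P.submatrix (Subtype.val : {v // v ≠ x 0} → V) Subtype.val).det := by
  have h := sum_treeWeight_mul_loopF x hP hirr
  rw [← Finset.sum_mul, loopF_erase_univ hP hirr (by simp)] at h
  rw [← det_one_sub_killed_erase_univ]
  exact eq_of_mul_inv_eq_one h

end Existence

/-! ### Kirchhoff's matrix-tree theorem. -/

section Kirchhoff

variable {V : Type*} [Fintype V] [DecidableEq V] (G : SimpleGraph V) [DecidableRel G.Adj]

/-- The transition matrix of the walk which moves to a uniformly chosen vertex among the current
one and its neighbours. -/
noncomputable def lazyWalk : Matrix V V ℝ :=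
  Matrix.of fun u v => (if u = v ∨ G.Adj u v then 1 else 0) / (G.degree u + 1)

variable {G}

theorem lazyWalk_eq (u v : V) :
    lazyWalk G u v = (G.degree u + 1 : ℝ)⁻¹ * ((1 : Matrix V V ℝ) u v + G.adjMatrix ℝ u v) := by
  rw [lazyWalk, Matrix.of_apply, div_eq_inv_mul, SimpleGraph.adjMatrix_apply, Matrix.one_apply]
  by_cases h : u = v
  · subst h
    simp
  · simp [h]

/-- Allowing the walk to stay put makes the normalization `degree + 1` positive, which covers the
one-vertex graph. -/
theorem lazyWalk_mem_rowStochastic : lazyWalk G ∈ Matrix.rowStochastic ℝ V := by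
  rw [Matrix.mem_rowStochastic_iff_sum]
  refine ⟨fun u v => by rw [lazyWalk, Matrix.of_apply]; positivity, fun u => ?_⟩
  simp_rw [lazyWalk_eq, ← Finset.mul_sum, Finset.sum_add_distrib]
  have h1 : ∑ v, (1 : Matrix V V ℝ) u v = 1 := by simp [Matrix.one_apply]
  have h2 : ∑ v, G.adjMatrix ℝ u v = G.degree u := by
    simp [SimpleGraph.adjMatrix_apply, ← SimpleGraph.card_neighborFinset_eq_degree,
      SimpleGraph.neighborFinset_eq_filter]
  rw [h1, h2, add_comm]
  exact inv_mul_cancel₀ (by positivity)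

theorem lazyWalk_isIrreducible (hG : G.Connected) : (lazyWalk G).IsIrreducible := by
  have hpos : ∀ u v, u = v ∨ G.Adj u v → 0 < lazyWalk G u v := by
    intro u v h
    rw [lazyWalk, Matrix.of_apply, if_pos h]
    positivity
  let := (lazyWalk G).toQuiver
  refine ⟨fun u v => Matrix.nonneg_of_mem_rowStochastic lazyWalk_mem_rowStochastic,
    fun u v => ?_⟩
  obtain ⟨p⟩ := hG.preconnected u v
  induction p with
  | @nil u =>
    let e : u ⟶ u := ⟨hpos u u (Or.inl rfl)⟩
    exact ⟨e.toPath, by simp⟩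
  | @cons a b _ h p ih =>
    obtain ⟨q, hq⟩ := ih
    let e : a ⟶ b := ⟨hpos a b (Or.inr h)⟩
    exact ⟨e.toPath.comp q, by simp⟩

/-- The weight of a step depends only on its starting vertex, and each vertex except the root starts
exactly one tree edge. Tree edges are never self-loops, so laziness adds no trees. -/
theorem treeWeight_lazyWalk {T : SimpleGraph V} (hT : T.IsTree) (r : V) [Decidable (T ≤ G)] :
    treeWeight (lazyWalk G) r T =
      if T ≤ G then ∏ v ∈ Finset.univ.erase r, (G.degree v + 1 : ℝ)⁻¹ else 0 := by
  obtain ⟨f, hf⟩ := exists_parent hT r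
  rw [treeWeight_eq_prod _ hf]
  split_ifs with h
  · refine Finset.prod_congr rfl fun u hu => ?_
    have hadj : G.Adj u (f u) := h ((hf u (f u)).mpr ⟨Finset.ne_of_mem_erase hu, rfl⟩).adj
    rw [lazyWalk, Matrix.of_apply, if_pos (Or.inr hadj), one_div]
  · by_contra hne
    replace hne := Finset.prod_ne_zero_iff.mp hne
    have key : ∀ u v, IsDirectedEdge T r u v → G.Adj u v := by
      intro u v huv
      obtain ⟨hu, rfl⟩ := (hf u v).mp huv
      have := hne u (by simp [hu])
      rw [lazyWalk, Matrix.of_apply] at this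
      by_contra hn
      exact this (by simp [hn, huv.adj.ne])
    refine h fun u v huv => ?_
    exact (isDirectedEdge_or hT huv).elim (key u v) fun h => (key v u h).symm

/-- The indicator of a component missing `r` is in the kernel of the Laplacian. It vanishes at `r`,
so it survives deletion of that row and column. -/
theorem det_lapMatrix_submatrix_of_not_connected (hG : ¬ G.Connected) (r : V) :
    ((G.lapMatrix ℝ).submatrix (Subtype.val : {v // v ≠ r} → V) Subtype.val).det = 0 := by
  classical
  obtain ⟨v, hv⟩ : ∃ v, ¬ G.Reachable v r := by
    by_contra! h
    exact hG { preconnected := fun a b => (h a).trans (h b).symm, nonempty := ⟨r⟩ }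
  let f : V → ℝ := fun u => if G.Reachable v u then 1 else 0
  have hf : Matrix.mulVec (G.lapMatrix ℝ) f = 0 := by
    rw [SimpleGraph.lapMatrix_mulVec_eq_zero_iff_forall_reachable]
    intro a b hab
    have : G.Reachable v a ↔ G.Reachable v b :=
      ⟨fun h => h.trans hab, fun h => h.trans hab.symm⟩
    simp only [f, this]
  rw [← Matrix.exists_mulVec_eq_zero_iff]
  have hvr : v ≠ r := by
    rintro rfl
    exact hv (SimpleGraph.Reachable.refl _)
  refine ⟨fun u => f u.1, fun h => ?_, ?_⟩
  · have := congrFun h ⟨v, hvr⟩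
    simp [f] at this
  · ext u
    have hu := congrFun hf u.1
    simp only [Matrix.mulVec, dotProduct, Matrix.submatrix_apply, Pi.zero_apply] at hu ⊢
    have hr : G.lapMatrix ℝ u.1 r * f r = 0 := by simp [f, hv]
    rw [← hu, ← Finset.sum_erase (f := fun w => G.lapMatrix ℝ u.1 w * f w) Finset.univ hr]
    exact (Finset.sum_subtype _ (by simp) fun w => G.lapMatrix ℝ u.1 w * f w).symm

theorem one_sub_lazyWalk (u v : V) : (1 - lazyWalk G) u v =
    (G.degree u + 1 : ℝ)⁻¹ * G.lapMatrix ℝ u v := by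
  have hpos : (G.degree u + 1 : ℝ) ≠ 0 := by positivity
  rw [Matrix.sub_apply, lazyWalk_eq, SimpleGraph.lapMatrix, Matrix.sub_apply,
    SimpleGraph.degMatrix, Matrix.diagonal_apply, Matrix.one_apply]
  split_ifs <;> field_simp <;> ring

theorem card_spanningTrees_eq_det [MeasurableSpace V] [MeasurableSingletonClass V] (r : V) :
    ((spanningTrees G).card : ℝ) =
      ((G.lapMatrix ℝ).submatrix (Subtype.val : {v // v ≠ r} → V) Subtype.val).det := by
  classical
  by_cases hG : G.Connected
  swap
  · rw [det_lapMatrix_submatrix_of_not_connected hG, Nat.cast_eq_zero, Finset.card_eq_zero,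
      Finset.eq_empty_iff_forall_notMem]
    intro T hT
    obtain ⟨h1, h2⟩ := (Set.Finite.mem_toFinset _).mp hT
    exact hG (h2.connected.mono h1)
  obtain ⟨n, hn⟩ : ∃ n, Fintype.card V = n + 1 :=
    Nat.exists_eq_succ_of_ne_zero (Fintype.card_pos_iff.mpr ⟨r⟩).ne'
  let e : Fin (n + 1) ≃ V := (Fintype.equivFinOfCardEq hn).symm
  -- The swap makes the prescribed vertex `r` the root `x 0`.
  let x : Fin (n + 1) ≃ V := e.trans (Equiv.swap (e 0) r)
  have hx : x 0 = r := by simp [x]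
  set c : ℝ := ∏ v ∈ Finset.univ.erase r, (G.degree v + 1 : ℝ)⁻¹ with hc
  have hc0 : c ≠ 0 := Finset.prod_ne_zero_iff.mpr fun v _ => by positivity
  have hmain := sum_treeWeight_eq_det x lazyWalk_mem_rowStochastic (lazyWalk_isIrreducible hG)
  rw [hx] at hmain
  have hleft : ∑ T ∈ spanningTrees (⊤ : SimpleGraph V), treeWeight (lazyWalk G) r T =
      (spanningTrees G).card * c := by
    rw [Finset.sum_congr rfl fun T hT =>
      treeWeight_lazyWalk (G := G) ((Set.Finite.mem_toFinset _).mp hT).2 r,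
      ← Finset.sum_filter, Finset.sum_const, nsmul_eq_mul]
    congr 3
    ext T
    simp only [Finset.mem_filter, spanningTrees, Set.Finite.mem_toFinset, Set.mem_ofPred_eq, le_top,
      true_and]
    exact and_comm
  have hright : (1 - (lazyWalk G).submatrix (Subtype.val : {v // v ≠ r} → V) Subtype.val).det =
      c * ((G.lapMatrix ℝ).submatrix (Subtype.val : {v // v ≠ r} → V) Subtype.val).det := by
    have h1 : 1 - (lazyWalk G).submatrix (Subtype.val : {v // v ≠ r} → V) Subtype.val =
        Matrix.diagonal (fun v : {v // v ≠ r} => (G.degree v.1 + 1 : ℝ)⁻¹) *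
          (G.lapMatrix ℝ).submatrix Subtype.val Subtype.val := by
      ext u v
      rw [Matrix.diagonal_mul, Matrix.submatrix_apply, ← one_sub_lazyWalk, Matrix.sub_apply,
        Matrix.sub_apply, Matrix.submatrix_apply, Matrix.one_apply, Matrix.one_apply]
      simp only [Subtype.ext_iff]
    rw [h1, Matrix.det_mul, Matrix.det_diagonal, hc]
    congr 1
    exact (Finset.prod_subtype (Finset.univ.erase r) (by simp) fun v => (G.degree v + 1 : ℝ)⁻¹).symm
  rw [hleft, hright, mul_comm] at hmain
  exact mul_left_cancel₀ hc0 hmain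

end Kirchhoff

theorem mainTheorem5 {V : Type*} [Fintype V] [DecidableEq V]
    [MeasurableSpace V] [MeasurableSingletonClass V] :
    (∀ (n : ℕ) (x : Fin (n + 1) ≃ V) (P : Matrix V V ℝ),
      P ∈ Matrix.rowStochastic ℝ V → P.IsIrreducible →
      ∀ l : List V, l.Nodup → (∀ v, v ∈ l ↔ v ≠ x 0) →
        (∀ {Ω : Type*} [MeasurableSpace Ω] (μ : Measure Ω) [IsProbabilityMeasure μ]
          (S : Fin n → ℕ → Ω → V),
          (∀ i, IsMarkovChainFrom μ P (x i.succ) (S i)) →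
          iIndepFun (fun (i : Fin n) (ω : Ω) (k : ℕ) => S i k ω) μ →
          (∀ᵐ ω ∂μ, wilson x (fun i k => S i k ω) ∈ spanningTrees (⊤ : SimpleGraph V)) ∧
          ∀ T ∈ spanningTrees (⊤ : SimpleGraph V),
            μ.real {ω | wilson x (fun i k => S i k ω) = T} =
              treeWeight P (x 0) T * loopF P (Finset.univ.erase (x 0)) l) ∧
        ∑ T ∈ spanningTrees (⊤ : SimpleGraph V), treeWeight P (x 0) T =
          (loopF P (Finset.univ.erase (x 0)) l)⁻¹ ∧
        (loopF P (Finset.univ.erase (x 0)) l)⁻¹ =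
          (1 - P.submatrix (Subtype.val : {v // v ≠ x 0} → V) Subtype.val).det) ∧
    (∀ (G : SimpleGraph V) [DecidableRel G.Adj] (r : V),
      ((spanningTrees G).card : ℝ) =
        ((G.lapMatrix ℝ).submatrix (Subtype.val : {v // v ≠ r} → V) Subtype.val).det) := by
  refine ⟨fun n x P hP hirr l _ hl => ?_, fun G _ r => card_spanningTrees_eq_det r⟩
  have hF := loopF_erase_univ hP hirr hl
  have hdet : (loopF P (Finset.univ.erase (x 0)) l)⁻¹ =
      (1 - P.submatrix (Subtype.val : {v // v ≠ x 0} → V) Subtype.val).det := by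
    rw [hF, inv_inv, det_one_sub_killed_erase_univ]
  refine ⟨fun μ _ S hS hind => ⟨ae_wilson_mem_spanningTrees hP hirr hS, fun T hT => ?_⟩, ?_, hdet⟩
  -- The law was computed with the enumeration `toList`; both it and `l` give the same inverse
  -- determinant.
  · rw [measureReal_def, (measure_wilson_eq hP hirr hS hind
      ((Set.Finite.mem_toFinset _).mp hT).2).2, ENNReal.toReal_ofReal, hF,
      loopF_erase_univ hP hirr (by simp)]
    exact mul_nonneg (Finset.prod_nonneg fun _ _ => hirr.nonneg _ _) (loopF_nonneg hP _ _)
  · rw [hdet, sum_treeWeight_eq_det x hP hirr]
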